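/- **Definitions.** Let $f\colon X\to\Sigma_O$ with $X\subseteq\{0,\dots,\sigma-1\}^n$. For $1\le i\le n$ and $0\le p<\sigma$ let $O_{i,p}$ be the diagonal $X\times X$ matrix with entries $O_{i,p}[x,x]=e^{2\pi \mathrm{i}\,p x_i/\sigma}$, and for $z\in\Sigma_O$ let $F_z$ be the diagonal projector onto the inputs $x$ with $f(x)=z$. For a complex Hermitian $X\times X$ matrix $\Gamma$ put $\Gamma_{i,p}=O_{i,p}^*\Gamma O_{i,p}$; norms are spectral norms. For real $\eta,\zeta$ define $$\mathrm{MADV}_{\eta,4\zeta}(f)=\sup_{\Gamma,\lambda}\frac{\log(\zeta^2\lambda)}{\log\bigl(\max_{i,p}\|\Gamma_{i,p}\Gamma^{-1}\|\bigr)},$$ where the supremum is over all positive definite $\Gamma$ with smallest eigenvalue $1$ and all $\lambda$ with $1<\lambda\le\|\Gamma\|$ such that $\|F_z\Pi_{\mathrm{bad}}\|^2\le\eta$ for every $z\in\Sigma_O$; here $\Pi_{\mathrm{bad}}$ is the orthogonal projector onto the span of the eigenspaces of $\Gamma$ with eigenvalue smaller than $\lambda$. (The parameters correspond to success probability $\eta+4\zeta$.)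 The $t$-fold search problem $\mathrm{Search}_{t,n}$ has as inputs the strings $x\in\{0,1\}^n$ with exactly $t$ ones, and $\mathrm{Search}_{t,n}(x)$ is the $t$-element set $J=\{i: x_i=1\}$. **Theorem.** There is an absolute constant $c>0$ such that for all integers $t\ge 1$ and $n$ with $t\le \frac{n}{4e}$, $$\mathrm{MADV}_{2^{-t/2},\,2^{-t/8}}(\mathrm{Search}_{t,n})\ \ge\ c\sqrt{tn}.$$ That is, the bound $\Omega(\sqrt{tn})$ holds with $\eta=2^{-t/2}$ and $4\zeta=2^{-t/8}$, both exponentially small in $t$. -/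

import Mathlib

open scoped ComplexOrder

/-- The spectral (Euclidean operator) norm of a complex square matrix. -/
noncomputable def opNorm {X : Type*} [Fintype X] [DecidableEq X] (M : Matrix X X ℂ) : ℝ :=
  ‖Matrix.toEuclideanCLM (n := X) (𝕜 := ℂ) M‖

/-- The diagonal block `O_{i,p}` of the phase query operator over the alphabet
`{0, …, σ-1}`: the diagonal entry at the input `x` is `exp ((2 π i / σ) p x_i)`. -/
noncomputable def queryOp {n σ : ℕ} (X : Finset (Fin n → Fin σ)) (i : Fin n) (p : Fin σ) :
    Matrix X X ℂ :=
  Matrix.diagonal fun x =>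
    Complex.exp (2 * Real.pi * Complex.I / σ * ((p : ℕ) : ℂ) * (((x : Fin n → Fin σ) i : ℕ) : ℂ))

/-- `Γ_{i,p} = O_{i,p}^* Γ O_{i,p}`. -/
noncomputable def queriedMatrix {n σ : ℕ} {X : Finset (Fin n → Fin σ)} (Γ : Matrix X X ℂ)
    (i : Fin n) (p : Fin σ) : Matrix X X ℂ :=
  (queryOp X i p).conjTranspose * Γ * queryOp X i p

/-- `max_{i,p} ‖Γ_{i,p} Γ⁻¹‖`, the maximal growth factor of the progress function in one query
(a supremum over the finite set of all pairs `(i, p)`). -/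
noncomputable def queryFactor {n σ : ℕ} {X : Finset (Fin n → Fin σ)} (Γ : Matrix X X ℂ) : ℝ :=
  ⨆ ip : Fin n × Fin σ, opNorm (queriedMatrix Γ ip.1 ip.2 * Γ⁻¹)

/-- The diagonal projector `F_z` onto the inputs `x` with `f x = z`. -/
def outputProj {n σ : ℕ} {X : Finset (Fin n → Fin σ)} {Out : Type*} [DecidableEq Out]
    (f : X → Out) (z : Out) : Matrix X X ℂ :=
  Matrix.diagonal fun x => if f x = z then 1 else 0

/-- The bad subspace: the span of all eigenspaces of `Γ` whose eigenvalue is smaller than `lam`. -/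
noncomputable def badSubspace {X : Type*} [Fintype X] [DecidableEq X] (Γ : Matrix X X ℂ)
    (lam : ℝ) : Submodule ℂ (EuclideanSpace ℂ X) :=
  ⨆ μ : {μ : ℝ // μ < lam}, Module.End.eigenspace (Matrix.toEuclideanLin Γ) ((μ : ℝ) : ℂ)

/-- `(Γ, lam)` is a multiplicative adversary for `f` with success `η` in the bad subspace:
`Γ` is positive definite with smallest eigenvalue `1`, `1 < lam ≤ ‖Γ‖`, and
`‖F_z Π_bad‖² ≤ η` for every output letter `z`. -/
structure IsMultAdversary {n σ : ℕ} {X : Finset (Fin n → Fin σ)} {Out : Type*} [DecidableEq Out]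
    (f : X → Out) (η : ℝ) (Γ : Matrix X X ℂ) (lam : ℝ) : Prop where
  posDef : Γ.PosDef
  smallest_eigenvalue :
    IsLeast {μ : ℝ | Module.End.HasEigenvalue (Matrix.toEuclideanLin Γ) (μ : ℂ)} 1
  one_lt : 1 < lam
  le_norm : lam ≤ opNorm Γ
  bad_success : ∀ z : Out,
    ‖(Matrix.toEuclideanCLM (n := X) (𝕜 := ℂ) (outputProj f z)).comp
      (badSubspace Γ lam).starProjection‖ ^ 2 ≤ η

/-- The multiplicative adversary bound `MADV_{η,s}(f)`, where the second parameter is `s = 4 ζ`: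
the supremum of `log (ζ² lam) / log (max_{i,p} ‖Γ_{i,p} Γ⁻¹‖)` over all multiplicative
adversaries `(Γ, lam)`. The denominator can vanish only for diagonal `Γ`, which is never
an adversary if `η < 1`. -/
noncomputable def madv {n σ : ℕ} {X : Finset (Fin n → Fin σ)} {Out : Type*} [DecidableEq Out]
    (f : X → Out) (η s : ℝ) : EReal :=
  sSup {r : EReal | ∃ (Γ : Matrix X X ℂ) (lam : ℝ), IsMultAdversary f η Γ lam ∧
    r = ((Real.log ((s / 4) ^ 2 * lam) / Real.log (queryFactor Γ) : ℝ) : EReal)}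

/-- The set of positions of the ones of a bit string. -/
def onesOf {n : ℕ} (x : Fin n → Fin 2) : Finset (Fin n) :=
  Finset.univ.filter fun i => x i = 1

/-- The `n`-bit strings of Hamming weight `t`. -/
def searchInputs (t n : ℕ) : Finset (Fin n → Fin 2) :=
  Finset.univ.filter fun x => (onesOf x).card = t

/-- The `t`-fold search problem: on a string of weight `t`, output the `t`-element set `J` of
positions of its ones. -/
def search (t n : ℕ) : searchInputs t n → {J : Finset (Fin n) // J.card = t} :=
  fun x => ⟨onesOf (x : Fin n → Fin 2), (Finset.mem_filter.mp x.2).2⟩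

/-!
The adversary matrix is `Γ = ∑ j, q ^ j Π_j` with the constant `q = 2 ^ 10`, where `Π_j` projects
onto the functions of exact degree `j` on the inputs: those of degree at most `j` that are
orthogonal to all functions of degree less than `j`. These spaces are the eigenspaces of the
Laplacian `L = ∑ (1 - τ)` of the Johnson graph, since `L` sends a monomial of degree `j` to
`2 j (n + 1 - j)` times itself plus terms of degree `j - 1` (`johnsonLap_monomialFn`). The threshold
is `lam = q ^ ⌈t / 2⌉`.

*Success in the bad subspace.* The bad subspace lies in the space `T` of functions of degree at most
`m = ⌈t / 2⌉ - 1`. An output determines the input, and all inputs are equivalent under permutations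
of the positions, so the success probability in `T` is `dim T / (n choose t)`
(`norm_outputProj_comp_sq_le`). As `n ≥ 10 t`, the binomial coefficients grow at least
ninefold at each step up to `t`, and this ratio is at most `2 ^ (-(t - m)) ≤ 2 ^ (-t / 2)`.

*Growth in one query.* Let `O` be the diagonal matrix of `(-1) ^ x_i`. It is a polynomial of degree
one, so it changes the degree by at most one, and `Γ O Γ⁻¹` arises from `O` by multiplying its
degree-raising part by `q` and its degree-lowering part by `q⁻¹`. The block of `O` from degree `j` to
degree `j + 1` is the block of the commutator `[L, O]` divided by the eigenvalue gap
`2 (n - 2 j) ≥ n`, and `[L, O]` is sparse: it only joins inputs that differ by moving a one into or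
out of the position `i`, and Cauchy-Schwarz bounds its norm by `4 √(t n)` (`norm_commutator_le`).
Therefore `‖Γ O Γ⁻¹‖ ≤ 1 + 4 q √(t n) / n` (`norm_gradedMatrix_conj_le`), whose logarithm is
`O(√(t / n))`, whereas `log (ζ² lam)` is at least of the order of `t`. The maximal growth factor is
strictly larger than `1`, because a query moves the constant function out of the constants
(`IsGradedEigenbasis.one_lt_queryFactor`), so the quotient of logarithms is a genuine one.
-/

open scoped Matrix.Norms.L2Operator Matrix

/-! ### Functions on the search inputs -/

/-- The permutation `x ↦ x ∘ π` of the search inputs induced by a permutation `π` of positions. -/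
def permInput {t n : ℕ} (π : Equiv.Perm (Fin n)) : Equiv.Perm (searchInputs t n) :=
  (Equiv.arrowCongr π.symm (Equiv.refl (Fin 2))).subtypeEquiv fun x => by
    have h : onesOf ((Equiv.arrowCongr π.symm (Equiv.refl (Fin 2))) x)
        = (onesOf x).map π.symm.toEmbedding := by
      ext i
      simp [onesOf, Finset.mem_map_equiv]
    simp only [searchInputs, Finset.mem_filter, Finset.mem_univ, true_and]
    rw [h, Finset.card_map]

@[simp] lemma permInput_apply {t n : ℕ} (π : Equiv.Perm (Fin n)) (x : searchInputs t n)
    (i : Fin n) : (permInput π x : Fin n → Fin 2) i = (x : Fin n → Fin 2) (π i) := rfl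

/-- The coordinate function `x ↦ x_i`, with complex values `0` and `1`. -/
def bit {t n : ℕ} (i : Fin n) (x : searchInputs t n) : ℂ := (((x : Fin n → Fin 2) i : ℕ) : ℂ)

/-- The multilinear monomial `∏_{a ∈ I} x_a`, as a function on the search inputs. -/
def monomialFn {t n : ℕ} (I : Finset (Fin n)) : searchInputs t n → ℂ := fun x => ∏ a ∈ I, bit a x

/-- The functions on the search inputs that are polynomials of degree at most `m`. -/
def degLE (t n m : ℕ) : Submodule ℂ (searchInputs t n → ℂ) :=
  Submodule.span ℂ (monomialFn '' {I : Finset (Fin n) | I.card ≤ m})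

/-- Twice the Laplacian of the Johnson graph: the sum of `1 - τ` over all ordered pairs `(a, b)`,
where `τ` exchanges the bits at the positions `a` and `b`. -/
def johnsonLap (t n : ℕ) : Matrix (searchInputs t n) (searchInputs t n) ℂ :=
  ∑ a : Fin n, ∑ b : Fin n, (1 - (permInput (Equiv.swap a b)).permMatrix ℂ)

/-- The eigenvalue `2 j (n + 1 - j)` of `johnsonLap` in degree `j`. -/
def johnsonEig (n j : ℕ) : ℝ := 2 * j * (n + 1 - j)

lemma bit_eq_ite {t n : ℕ} (i : Fin n) (x : searchInputs t n) :
    bit i x = if (x : Fin n → Fin 2) i = 1 then 1 else 0 := by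
  unfold bit
  generalize (x : Fin n → Fin 2) i = b
  fin_cases b <;> simp

lemma bit_eq_zero_or_one {t n : ℕ} (i : Fin n) (x : searchInputs t n) :
    bit i x = 0 ∨ bit i x = 1 := by
  rw [bit_eq_ite]
  split_ifs <;> simp

lemma bit_mul_self {t n : ℕ} (i : Fin n) (x : searchInputs t n) : bit i x * bit i x = bit i x := by
  rcases bit_eq_zero_or_one i x with h | h <;> simp [h]

lemma card_onesOf {t n : ℕ} (x : searchInputs t n) : (onesOf (x : Fin n → Fin 2)).card = t :=
  (Finset.mem_filter.mp x.2).2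

lemma sum_bit {t n : ℕ} (x : searchInputs t n) : ∑ i, bit i x = t := by
  simp_rw [bit_eq_ite]
  rw [Finset.sum_boole]
  exact congrArg Nat.cast (card_onesOf x)

/-! ### The Johnson Laplacian and the degree filtration -/

lemma johnsonLap_mulVec {t n : ℕ} (v : searchInputs t n → ℂ) (x : searchInputs t n) :
    (johnsonLap t n).mulVec v x =
      ∑ a : Fin n, ∑ b : Fin n, (v x - v (permInput (Equiv.swap a b) x)) := by
  simp only [johnsonLap, Matrix.sum_mulVec, Matrix.sub_mulVec, Matrix.one_mulVec,
    Matrix.permMatrix_mulVec, Finset.sum_apply, Pi.sub_apply, Function.comp]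

lemma permInput_mul {t n : ℕ} (π ρ : Equiv.Perm (Fin n)) :
    (permInput (π * ρ) : Equiv.Perm (searchInputs t n)) = permInput ρ * permInput π := by
  ext x i
  simp

lemma permInput_one {t n : ℕ} :
    (permInput (1 : Equiv.Perm (Fin n)) : Equiv.Perm (searchInputs t n)) = 1 := by
  ext x i
  simp

lemma permInput_inv {t n : ℕ} (π : Equiv.Perm (Fin n)) :
    (permInput π : Equiv.Perm (searchInputs t n))⁻¹ = permInput π⁻¹ := by
  rw [inv_eq_iff_mul_eq_one, ← permInput_mul, inv_mul_cancel, permInput_one]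

lemma johnsonLap_isHermitian (t n : ℕ) : (johnsonLap t n).IsHermitian := by
  simp only [Matrix.IsHermitian, johnsonLap, Matrix.conjTranspose_sum, Matrix.conjTranspose_sub,
    Matrix.conjTranspose_one, Matrix.conjTranspose_permMatrix, permInput_inv, Equiv.swap_inv]

lemma monomialFn_mem {t n m : ℕ} {I : Finset (Fin n)} (h : I.card ≤ m) :
    monomialFn I ∈ degLE t n m :=
  Submodule.subset_span ⟨I, h, rfl⟩

lemma degLE_mono {t n : ℕ} : Monotone (degLE t n) := fun _ _ h =>
  Submodule.span_mono (Set.image_mono fun _ hI => le_trans hI h)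

lemma monomialFn_permInput {t n : ℕ} (π : Equiv.Perm (Fin n)) (I : Finset (Fin n))
    (x : searchInputs t n) :
    monomialFn I (permInput π x) = monomialFn (I.map π.toEmbedding) x := by
  simp [monomialFn, bit]

/-- The indicator function of an input `z` is the monomial on the set of its ones. -/
lemma monomialFn_onesOf {t n : ℕ} (z : searchInputs t n) :
    monomialFn (onesOf (z : Fin n → Fin 2)) = Pi.single z (1 : ℂ) := by
  ext x
  by_cases hx : x = z
  · subst hx
    simp only [Pi.single_eq_same, monomialFn]
    refine Finset.prod_eq_one fun a ha => ?_
    rw [bit_eq_ite, if_pos (Finset.mem_filter.mp ha).2]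
  · rw [Pi.single_eq_of_ne hx]
    have hne : ∃ a ∈ onesOf (z : Fin n → Fin 2), (x : Fin n → Fin 2) a ≠ 1 := by
      by_contra! hcon
      apply hx
      have hsub : onesOf (z : Fin n → Fin 2) ⊆ onesOf (x : Fin n → Fin 2) := fun a ha =>
        Finset.mem_filter.mpr ⟨Finset.mem_univ _, hcon a ha⟩
      have heq := Finset.eq_of_subset_of_card_le hsub (by rw [card_onesOf, card_onesOf])
      ext a
      have := congrArg (a ∈ ·) heq
      simp only [onesOf, Finset.mem_filter, Finset.mem_univ, true_and, eq_iff_iff] at this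
      omega
    obtain ⟨a, ha, hxa⟩ := hne
    exact Finset.prod_eq_zero ha (by rw [bit_eq_ite, if_neg hxa])

lemma degLE_self (t n : ℕ) : degLE t n t = ⊤ := by
  rw [eq_top_iff]
  intro v _
  have : v = ∑ z, v z • (Pi.single z (1 : ℂ) : searchInputs t n → ℂ) := by
    simpa using pi_eq_sum_univ' v
  rw [this]
  refine Submodule.sum_mem _ fun z _ => Submodule.smul_mem _ _ ?_
  rw [← monomialFn_onesOf]
  exact monomialFn_mem (card_onesOf z).le

lemma bit_mul_mem_degLE {t n m : ℕ} (i : Fin n) {v : searchInputs t n → ℂ}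
    (hv : v ∈ degLE t n m) : (fun x => bit i x * v x) ∈ degLE t n (m + 1) := by
  induction hv using Submodule.span_induction with
  | mem v hv =>
    obtain ⟨I, hI, rfl⟩ := hv
    have : (fun x : searchInputs t n => bit i x * monomialFn I x) = monomialFn (insert i I) := by
      ext x
      by_cases hi : i ∈ I
      · rw [Finset.insert_eq_of_mem hi, monomialFn, ← Finset.mul_prod_erase I _ hi, ← mul_assoc,
          bit_mul_self]
      · rw [monomialFn, monomialFn, Finset.prod_insert hi]
    rw [this]
    exact monomialFn_mem ((Finset.card_insert_le _ _).trans (Nat.succ_le_succ hI))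
  | zero =>
    simp only [Pi.zero_apply, mul_zero]
    exact Submodule.zero_mem _
  | add v w _ _ hv hw =>
    convert Submodule.add_mem _ hv hw using 1
    ext x
    simp [mul_add]
  | smul c v _ hv =>
    have := Submodule.smul_mem _ c hv
    convert this using 1
    ext x
    simp [mul_left_comm]

/-- A monomial of degree `j` is an eigenfunction of the Laplacian up to lower-degree terms. -/
lemma johnsonLap_monomialFn {t n : ℕ} (I : Finset (Fin n)) :
    (johnsonLap t n).mulVec (monomialFn I) =
      (johnsonEig n I.card : ℂ) • monomialFn I -
        (2 * (t - I.card + 1) : ℂ) • ∑ a ∈ I, monomialFn (I.erase a) := by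
  ext x
  rw [johnsonLap_mulVec]
  set g : Fin n → Fin n → ℂ := fun a b =>
    monomialFn I x - monomialFn I (permInput (Equiv.swap a b) x) with hg
  have hsymm : ∀ a b, g a b = g b a := fun a b => by simp only [hg, Equiv.swap_comm]
  have hfix : ∀ a b, (a ∈ I ↔ b ∈ I) → g a b = 0 := by
    intro a b hab
    simp only [hg, monomialFn_permInput]
    rw [sub_eq_zero]
    congr 1
    ext c
    rw [Finset.mem_map_equiv, Equiv.symm_swap]
    rcases eq_or_ne c a with rfl | hca
    · simp [hab]
    rcases eq_or_ne c b with rfl | hcb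
    · simp [hab]
    rw [Equiv.swap_apply_of_ne_of_ne hca hcb]
  have hmove : ∀ a ∈ I, ∀ b ∉ I, g a b = monomialFn I x - bit b x * monomialFn (I.erase a) x := by
    intro a ha b hb
    simp only [hg, monomialFn_permInput]
    have hmap : I.map (Equiv.swap a b).toEmbedding = insert b (I.erase a) := by
      ext c
      rw [Finset.mem_map_equiv, Equiv.symm_swap, Finset.mem_insert, Finset.mem_erase]
      rcases eq_or_ne c a with rfl | hca
      · have : c ≠ b := fun h => hb (h ▸ ha)
        simp [hb, this]
      rcases eq_or_ne c b with rfl | hcb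
      · simp [ha]
      simp [Equiv.swap_apply_of_ne_of_ne hca hcb, hca, hcb]
    rw [hmap]
    conv_lhs => rw [monomialFn, monomialFn, Finset.prod_insert (by simp [hb])]
    rfl
  have hsum : ∀ a ∈ I, ∑ b ∈ Iᶜ, g a b =
      (n - I.card + 1) * monomialFn I x - (t - I.card + 1) * monomialFn (I.erase a) x := by
    intro a ha
    have hbits : (∑ b ∈ Iᶜ, bit b x) * monomialFn (I.erase a) x =
        (t - I.card + 1) * monomialFn (I.erase a) x - monomialFn I x := by
      have h1 : ∑ b ∈ Iᶜ, bit b x = t - ∑ b ∈ I, bit b x := by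
        rw [← sum_bit x, ← Finset.sum_add_sum_compl I]; ring
      have h2 : (∑ b ∈ I.erase a, bit b x) * monomialFn (I.erase a) x =
          ((I.card : ℂ) - 1) * monomialFn (I.erase a) x := by
        rw [Finset.sum_mul, Finset.sum_congr rfl (g := fun _ => monomialFn (I.erase a) x)]
        · rw [Finset.sum_const, Finset.card_erase_of_mem ha, nsmul_eq_mul,
            Nat.cast_sub (Finset.card_pos.mpr ⟨a, ha⟩), Nat.cast_one]
        · intro b hb
          rw [monomialFn, ← Finset.mul_prod_erase _ _ hb, ← mul_assoc, bit_mul_self]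
      have h3 : bit a x * monomialFn (I.erase a) x = monomialFn I x :=
        Finset.mul_prod_erase I (fun b => bit b x) ha
      rw [h1, ← Finset.add_sum_erase I _ ha]
      linear_combination -h2 - h3
    rw [Finset.sum_congr rfl fun b hb => hmove a ha b (Finset.mem_compl.mp hb),
      Finset.sum_sub_distrib, ← Finset.sum_mul, hbits, Finset.sum_const, Finset.card_compl,
      Fintype.card_fin, nsmul_eq_mul, Nat.cast_sub (by simpa using Finset.card_le_univ I)]
    ring
  have hsplit : ∑ a, ∑ b, g a b = 2 * ∑ a ∈ I, ∑ b ∈ Iᶜ, g a b := by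
    rw [← Finset.sum_add_sum_compl I]
    have h1 : ∑ a ∈ I, ∑ b, g a b = ∑ a ∈ I, ∑ b ∈ Iᶜ, g a b := by
      refine Finset.sum_congr rfl fun a ha => ?_
      rw [← Finset.sum_add_sum_compl I, Finset.sum_eq_zero, zero_add]
      exact fun b hb => hfix a b (by simp [ha, hb])
    have h2 : ∑ a ∈ Iᶜ, ∑ b, g a b = ∑ a ∈ Iᶜ, ∑ b ∈ I, g a b := by
      refine Finset.sum_congr rfl fun a ha => ?_
      rw [← Finset.sum_add_sum_compl I, add_eq_left]
      exact Finset.sum_eq_zero fun b hb =>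
        hfix a b (by rw [Finset.mem_compl] at ha hb; simp [ha, hb])
    rw [h1, h2, Finset.sum_comm (s := Iᶜ), two_mul]
    simp only [hsymm]
  rw [hsplit, Finset.sum_congr rfl hsum, Finset.sum_sub_distrib, Finset.sum_const, nsmul_eq_mul,
    ← Finset.mul_sum]
  simp only [johnsonEig, Pi.sub_apply, Pi.smul_apply, smul_eq_mul, Finset.sum_apply]
  push_cast
  ring

/-- On polynomials of degree at most `m`, the Laplacian is the scalar `johnsonEig n m` modulo
polynomials of smaller degree. -/
lemma johnsonLap_sub_mem {t n m : ℕ} {v : searchInputs t n → ℂ} (hv : v ∈ degLE t n (m + 1)) :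
    (johnsonLap t n).mulVec v - (johnsonEig n (m + 1) : ℂ) • v ∈ degLE t n m := by
  induction hv using Submodule.span_induction with
  | mem v hv =>
    obtain ⟨I, hI, rfl⟩ := hv
    have hlow : (2 * (t - I.card + 1) : ℂ) • ∑ a ∈ I, monomialFn (I.erase a) ∈ degLE t n m := by
      refine Submodule.smul_mem _ _ (Submodule.sum_mem _ fun a ha => monomialFn_mem ?_)
      have : I.card ≤ m + 1 := hI
      rw [Finset.card_erase_of_mem ha]
      omega
    rw [johnsonLap_monomialFn, sub_right_comm]
    refine Submodule.sub_mem _ ?_ hlow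
    rcases Nat.lt_or_ge m I.card with h | h
    · have hcard : I.card = m + 1 := le_antisymm hI h
      rw [hcard, sub_self]
      exact Submodule.zero_mem _
    · exact Submodule.sub_mem _ (Submodule.smul_mem _ _ (monomialFn_mem h))
        (Submodule.smul_mem _ _ (monomialFn_mem h))
  | zero => simp
  | add v w _ _ hv hw =>
    rw [Matrix.mulVec_add, smul_add, add_sub_add_comm]
    exact Submodule.add_mem _ hv hw
  | smul c v _ hv =>
    rw [Matrix.mulVec_smul, smul_comm, ← smul_sub]
    exact Submodule.smul_mem _ _ hv

lemma mem_degLE_zero {t n : ℕ} {v : searchInputs t n → ℂ} :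
    v ∈ degLE t n 0 ↔ ∃ c : ℂ, v = fun _ => c := by
  have h : (monomialFn '' {I : Finset (Fin n) | I.card ≤ 0} : Set (searchInputs t n → ℂ))
      = {fun _ => 1} := by
    have : {I : Finset (Fin n) | I.card ≤ 0} = {∅} := by ext; simp
    rw [this, Set.image_singleton]
    congr 1
  rw [degLE, h, Submodule.mem_span_singleton]
  refine exists_congr fun c => ?_
  rw [eq_comm]
  refine Eq.congr_right ?_
  ext; simp

lemma johnsonLap_of_mem_degLE_zero {t n : ℕ} {v : searchInputs t n → ℂ}
    (hv : v ∈ degLE t n 0) : (johnsonLap t n).mulVec v = 0 := by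
  obtain ⟨c, rfl⟩ := mem_degLE_zero.mp hv
  ext x
  simp [johnsonLap_mulVec]

/-! ### Dimensions and symmetry -/

lemma finrank_degLE_le (t n m : ℕ) :
    Module.finrank ℂ (degLE t n m) ≤ ∑ i ∈ Finset.range (m + 1), n.choose i := by
  classical
  have himg : (monomialFn '' {I : Finset (Fin n) | I.card ≤ m} : Set (searchInputs t n → ℂ)) =
      ((Finset.univ.filter fun I : Finset (Fin n) => I.card ≤ m).image monomialFn :
        Finset (searchInputs t n → ℂ)) := by
    ext; simp
  rw [degLE, himg]
  refine (finrank_span_finset_le_card _).trans (Finset.card_image_le.trans ?_)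
  have : (Finset.univ.filter fun I : Finset (Fin n) => I.card ≤ m) =
      (Finset.range (m + 1)).biUnion fun i => Finset.powersetCard i Finset.univ := by
    ext I; simp
  rw [this]
  refine Finset.card_biUnion_le.trans (Finset.sum_le_sum fun i _ => ?_)
  simp

lemma card_searchInputs (t n : ℕ) : Fintype.card (searchInputs t n) = n.choose t := by
  classical
  rw [Fintype.card_coe]
  have : (searchInputs t n).card = (Finset.powersetCard t (Finset.univ : Finset (Fin n))).card := by
    refine Finset.card_bij (fun x _ => onesOf x) ?_ ?_ ?_
    · intro x hx
      simpa [searchInputs, Finset.mem_powersetCard] using hx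
    · intro x _ y _ hxy
      ext a
      have := congrArg (a ∈ ·) hxy
      simp only [onesOf, Finset.mem_filter, Finset.mem_univ, true_and, eq_iff_iff] at this
      omega
    · intro J hJ
      have hones : onesOf (fun i => if i ∈ J then (1 : Fin 2) else 0) = J := by
        ext i; simp [onesOf]
      refine ⟨fun i => if i ∈ J then 1 else 0, ?_, hones⟩
      simpa [searchInputs, hones, Finset.mem_powersetCard] using hJ
  rw [this]
  simp

lemma search_injective (t n : ℕ) : Function.Injective (search t n) := by
  intro x y hxy
  have h : onesOf (x : Fin n → Fin 2) = onesOf (y : Fin n → Fin 2) := congrArg Subtype.val hxy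
  ext a
  have := congrArg (a ∈ ·) h
  simp only [onesOf, Finset.mem_filter, Finset.mem_univ, true_and, eq_iff_iff] at this
  omega

/-- The symmetric group acts transitively on the search inputs. -/
lemma exists_permInput_eq {t n : ℕ} (x y : searchInputs t n) :
    ∃ π : Equiv.Perm (Fin n), permInput π x = y := by
  classical
  have hcard : Fintype.card {i // i ∈ onesOf (y : Fin n → Fin 2)} =
      Fintype.card {i // i ∈ onesOf (x : Fin n → Fin 2)} := by
    rw [Fintype.card_coe, Fintype.card_coe, card_onesOf, card_onesOf]
  let e := Fintype.equivOfCardEq hcard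
  refine ⟨e.extendSubtype, ?_⟩
  ext i
  rw [permInput_apply]
  by_cases hi : i ∈ onesOf (y : Fin n → Fin 2)
  · have h1 := e.extendSubtype_mem i hi
    rw [(Finset.mem_filter.mp h1).2, (Finset.mem_filter.mp hi).2]
  · have h1 : e.extendSubtype i ∉ onesOf (x : Fin n → Fin 2) := e.extendSubtype_not_mem i hi
    simp only [onesOf, Finset.mem_filter, Finset.mem_univ, true_and] at h1 hi
    have hbits : ∀ u v : Fin 2, u ≠ 1 → v ≠ 1 → u = v := by decide
    exact congrArg Fin.val (hbits _ _ h1 hi)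

/-- Composition with a permutation of the positions preserves the degree. -/
lemma comp_permInput_mem_degLE {t n m : ℕ} (π : Equiv.Perm (Fin n)) {v : searchInputs t n → ℂ}
    (hv : v ∈ degLE t n m) : (fun x => v (permInput π x)) ∈ degLE t n m := by
  induction hv using Submodule.span_induction with
  | mem v hv =>
    obtain ⟨I, hI, rfl⟩ := hv
    simp only [monomialFn_permInput]
    exact monomialFn_mem (by simpa using hI)
  | zero => exact Submodule.zero_mem _
  | add v w _ _ hv hw => exact Submodule.add_mem _ hv hw
  | smul c v _ hv => exact Submodule.smul_mem _ c hv

/-! ### Conjugation by a graded matrix -/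

section Blocks

variable {X : Type*} [Fintype X] [DecidableEq X]

lemma opNorm_eq_norm (M : Matrix X X ℂ) : opNorm M = ‖M‖ := rfl

/-- A bound on the spectral norm, tested on vectors. -/
lemma norm_le_of_sum_sq_le {M : Matrix X X ℂ} {K : ℝ} (hK : 0 ≤ K)
    (h : ∀ v : X → ℂ, ∑ k, ‖(M *ᵥ v) k‖ ^ 2 ≤ K ^ 2 * ∑ k, ‖v k‖ ^ 2) : ‖M‖ ≤ K := by
  refine ContinuousLinearMap.opNorm_le_bound _ hK fun v => ?_
  refine (sq_le_sq₀ (norm_nonneg _) (by positivity)).mp ?_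
  rw [mul_pow, EuclideanSpace.norm_sq_eq, EuclideanSpace.norm_sq_eq]
  exact h v.ofLp

lemma sum_sq_mulVec_le (M : Matrix X X ℂ) (v : X → ℂ) :
    ∑ k, ‖(M *ᵥ v) k‖ ^ 2 ≤ ‖M‖ ^ 2 * ∑ k, ‖v k‖ ^ 2 := by
  have h := Matrix.l2_opNorm_mulVec M (WithLp.toLp 2 v)
  have h2 := pow_le_pow_left₀ (norm_nonneg _) h 2
  rw [mul_pow, EuclideanSpace.norm_sq_eq, EuclideanSpace.norm_sq_eq] at h2
  exact h2

/-- The part of a matrix that raises a grading `d` by one, with each of its blocks rescaled, is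
bounded by the whole matrix: its blocks have mutually orthogonal domains and ranges. -/
lemma norm_raising_part_le {B C : Matrix X X ℂ} {d : X → ℕ} {s : ℕ → ℂ} {S : ℝ}
    (hB : ∀ k l, B k l = if d k = d l + 1 then s (d l) * C k l else 0)
    (hs : ∀ l, ‖s (d l)‖ ≤ S) (hS : 0 ≤ S) : ‖B‖ ≤ S * ‖C‖ := by
  refine norm_le_of_sum_sq_le (by positivity) fun v => ?_
  set w : ℕ → X → ℂ := fun j l => if d l = j then v l else 0 with hw
  have hrow : ∀ k, ‖(B *ᵥ v) k‖ ^ 2 ≤ S ^ 2 * ∑ j ∈ Finset.univ.image d, ‖(C *ᵥ w j) k‖ ^ 2 := by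
    intro k
    have hnn : 0 ≤ S ^ 2 * ∑ j ∈ Finset.univ.image d, ‖(C *ᵥ w j) k‖ ^ 2 := by positivity
    by_cases hk : ∃ l, d k = d l + 1
    · obtain ⟨l₀, hl₀⟩ := hk
      have hval : (B *ᵥ v) k = s (d l₀) * (C *ᵥ w (d l₀)) k := by
        simp only [Matrix.mulVec, dotProduct, Finset.mul_sum, hB, hw]
        refine Finset.sum_congr rfl fun l _ => ?_
        by_cases hl : d l = d l₀
        · simp [hl, hl₀, mul_assoc]
        · have : ¬ d k = d l + 1 := by omega
          simp [hl, this]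
      rw [hval, norm_mul, mul_pow]
      have h1 : ‖(C *ᵥ w (d l₀)) k‖ ^ 2 ≤ ∑ j ∈ Finset.univ.image d, ‖(C *ᵥ w j) k‖ ^ 2 :=
        Finset.single_le_sum (f := fun j => ‖(C *ᵥ w j) k‖ ^ 2) (fun _ _ => by positivity)
          (Finset.mem_image_of_mem d (Finset.mem_univ l₀))
      have h2 := hs l₀
      gcongr
    · have hval : (B *ᵥ v) k = 0 := by
        simp only [Matrix.mulVec, dotProduct, hB]
        refine Finset.sum_eq_zero fun l _ => ?_
        rw [if_neg fun h => hk ⟨l, h⟩, zero_mul]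
      rw [hval]
      simpa using hnn
  have hmass : ∑ j ∈ Finset.univ.image d, ∑ l, ‖w j l‖ ^ 2 = ∑ l, ‖v l‖ ^ 2 := by
    rw [Finset.sum_comm]
    refine Finset.sum_congr rfl fun l _ => ?_
    rw [Finset.sum_eq_single (d l)]
    · simp [hw]
    · intro j _ hj
      simp [hw, hj.symm]
    · simp
  calc ∑ k, ‖(B *ᵥ v) k‖ ^ 2
      ≤ ∑ k, S ^ 2 * ∑ j ∈ Finset.univ.image d, ‖(C *ᵥ w j) k‖ ^ 2 :=
        Finset.sum_le_sum fun k _ => hrow k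
    _ = S ^ 2 * ∑ j ∈ Finset.univ.image d, ∑ k, ‖(C *ᵥ w j) k‖ ^ 2 := by
        rw [← Finset.mul_sum, Finset.sum_comm]
    _ ≤ S ^ 2 * ∑ j ∈ Finset.univ.image d, ‖C‖ ^ 2 * ∑ l, ‖w j l‖ ^ 2 := by
        gcongr with j _
        exact sum_sq_mulVec_le C (w j)
    _ = (S * ‖C‖) ^ 2 * ∑ l, ‖v l‖ ^ 2 := by
        rw [← Finset.mul_sum, hmass]
        ring

lemma norm_unitary_conj (U : Matrix.unitaryGroup X ℂ) (M : Matrix X X ℂ) :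
    ‖(U : Matrix X X ℂ) * M * (U : Matrix X X ℂ)ᴴ‖ = ‖M‖ := by
  have h := CStarRing.norm_mul_coe_unitary ((U : Matrix X X ℂ) * M) (star U)
  rw [CStarRing.norm_coe_unitary_mul] at h
  exact h

lemma norm_unitary_conj' (U : Matrix.unitaryGroup X ℂ) (M : Matrix X X ℂ) :
    ‖(U : Matrix X X ℂ)ᴴ * M * (U : Matrix X X ℂ)‖ = ‖M‖ := by
  have h := norm_unitary_conj (star U) M
  simpa [← Matrix.star_eq_conjTranspose] using h

lemma unitary_conjTranspose_mul (U : Matrix.unitaryGroup X ℂ) :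
    (U : Matrix X X ℂ)ᴴ * (U : Matrix X X ℂ) = 1 := Matrix.UnitaryGroup.star_mul_self U

lemma unitary_mul_conjTranspose (U : Matrix.unitaryGroup X ℂ) :
    (U : Matrix X X ℂ) * (U : Matrix X X ℂ)ᴴ = 1 := Unitary.mul_star_self_of_mem U.2

/-- The matrix with eigenvalue `q ^ d k` on the column `k` of the unitary `U`. -/
def gradedMatrix (U : Matrix.unitaryGroup X ℂ) (d : X → ℕ) (q : ℝ) : Matrix X X ℂ :=
  (U : Matrix X X ℂ) * Matrix.diagonal (fun k => ((q ^ d k : ℝ) : ℂ)) * (U : Matrix X X ℂ)ᴴ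

lemma gradedMatrix_mul_inv (U : Matrix.unitaryGroup X ℂ) (d : X → ℕ) {q : ℝ} (hq : 0 < q) :
    gradedMatrix U d q * gradedMatrix U d q⁻¹ = 1 := by
  have hdiag : Matrix.diagonal (fun k => ((q ^ d k : ℝ) : ℂ)) *
      Matrix.diagonal (fun k => ((q⁻¹ ^ d k : ℝ) : ℂ)) = 1 := by
    rw [Matrix.diagonal_mul_diagonal, ← Matrix.diagonal_one]
    congr 1
    ext k
    rw [← Complex.ofReal_mul, ← mul_pow, mul_inv_cancel₀ hq.ne', one_pow, Complex.ofReal_one]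
  calc gradedMatrix U d q * gradedMatrix U d q⁻¹
      = (U : Matrix X X ℂ) * (Matrix.diagonal (fun k => ((q ^ d k : ℝ) : ℂ)) *
          ((U : Matrix X X ℂ)ᴴ * (U : Matrix X X ℂ)) *
          Matrix.diagonal (fun k => ((q⁻¹ ^ d k : ℝ) : ℂ))) * (U : Matrix X X ℂ)ᴴ := by
        simp only [gradedMatrix, Matrix.mul_assoc]
    _ = 1 := by
        rw [unitary_conjTranspose_mul, Matrix.mul_one, hdiag, Matrix.mul_one,
          unitary_mul_conjTranspose]

lemma gradedMatrix_inv (U : Matrix.unitaryGroup X ℂ) (d : X → ℕ) {q : ℝ} (hq : 0 < q) :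
    (gradedMatrix U d q)⁻¹ = gradedMatrix U d q⁻¹ :=
  Matrix.inv_eq_right_inv (gradedMatrix_mul_inv U d hq)

/-- If `O` changes the grading by at most one, then conjugating it by the graded matrix only
rescales its raising and lowering parts, and these parts are recovered from the commutator of `O`
with any matrix `L` that is scalar on each degree, by division by the gap of eigenvalues. -/
lemma norm_gradedMatrix_conj_le {U : Matrix.unitaryGroup X ℂ} {d : X → ℕ} {q : ℝ} (hq : 1 ≤ q)
    {L O : Matrix X X ℂ} (hO : O.IsHermitian) {θ : ℕ → ℝ} {g : ℝ} (hg : 0 < g)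
    (hL : L * (U : Matrix X X ℂ) = (U : Matrix X X ℂ) * Matrix.diagonal fun k => (θ (d k) : ℂ))
    (hgap : ∀ k, g ≤ θ (d k + 1) - θ (d k))
    (htri : ∀ k l, d l + 1 < d k → ((U : Matrix X X ℂ)ᴴ * O * (U : Matrix X X ℂ)) k l = 0) :
    ‖gradedMatrix U d q * O * (gradedMatrix U d q)⁻¹‖ ≤ ‖O‖ + q * (g⁻¹ * ‖L * O - O * L‖) := by
  have hq0 : 0 < q := by linarith
  set V : Matrix X X ℂ := (U : Matrix X X ℂ) with hV
  have hVV : Vᴴ * V = 1 := unitary_conjTranspose_mul U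
  have hVV' : V * Vᴴ = 1 := unitary_mul_conjTranspose U
  set O' := Vᴴ * O * V with hO'
  set D : Matrix X X ℂ := Matrix.diagonal fun k => (θ (d k) : ℂ) with hD
  have hO'H : O'.IsHermitian := Matrix.isHermitian_conjTranspose_mul_mul V hO
  have htri' : ∀ k l, d k + 1 < d l → O' k l = 0 := by
    intro k l h
    rw [← hO'H.apply, htri l k h, star_zero]
  -- The lowering part is the adjoint of the raising part, since `O` is Hermitian.
  set B : Matrix X X ℂ := Matrix.of fun k l => if d k = d l + 1 then O' k l else 0 with hB
  set C' := Vᴴ * (L * O - O * L) * V with hC'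
  have hLH : Vᴴ * L = D * Vᴴ ↔ L * V = V * D := by
    constructor
    · intro h
      calc L * V = V * (Vᴴ * L) * V := by rw [← Matrix.mul_assoc, hVV', Matrix.one_mul]
        _ = V * D * (Vᴴ * V) := by rw [h]; simp only [Matrix.mul_assoc]
        _ = V * D := by rw [hVV, Matrix.mul_one]
    · intro h
      calc Vᴴ * L = Vᴴ * (L * V) * Vᴴ := by
            rw [Matrix.mul_assoc, Matrix.mul_assoc, hVV', Matrix.mul_one]
        _ = (Vᴴ * V) * D * Vᴴ := by rw [h]; simp only [Matrix.mul_assoc]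
        _ = D * Vᴴ := by rw [hVV, Matrix.one_mul]
  have hC'eq : C' = D * O' - O' * D := by
    have h1 : Vᴴ * (L * O) * V = D * O' := by
      rw [← Matrix.mul_assoc, hLH.mpr hL, hO']; simp only [Matrix.mul_assoc]
    have h2 : Vᴴ * (O * L) * V = O' * D := by
      rw [hO', Matrix.mul_assoc, Matrix.mul_assoc O, hL]; simp only [Matrix.mul_assoc]
    rw [hC', Matrix.mul_sub, Matrix.sub_mul, h1, h2]
  have hBC : ∀ k l, B k l =
      if d k = d l + 1 then ((θ (d l + 1) - θ (d l) : ℝ) : ℂ)⁻¹ * C' k l else 0 := by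
    intro k l
    simp only [hB, Matrix.of_apply]
    split_ifs with h
    · have hne : ((θ (d l + 1) - θ (d l) : ℝ) : ℂ) ≠ 0 := by
        exact_mod_cast (hg.trans_le (hgap l)).ne'
      rw [hC'eq, Matrix.sub_apply, Matrix.diagonal_mul, Matrix.mul_diagonal, h, mul_comm (O' k l),
        ← sub_mul, ← Complex.ofReal_sub, inv_mul_cancel_left₀ hne]
    · rfl
  have hBnorm : ‖B‖ ≤ g⁻¹ * ‖L * O - O * L‖ := by
    rw [← norm_unitary_conj' U (L * O - O * L)]
    refine norm_raising_part_le (s := fun j => ((θ (j + 1) - θ j : ℝ) : ℂ)⁻¹) hBC (fun l => ?_)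
      (by positivity)
    rw [norm_inv, Complex.norm_real]
    exact inv_anti₀ hg ((hgap l).trans (le_abs_self _))
  have hconj : gradedMatrix U d q * O * (gradedMatrix U d q)⁻¹ =
      V * (O' + ((q - 1 : ℝ) : ℂ) • B + ((q⁻¹ - 1 : ℝ) : ℂ) • Bᴴ) * Vᴴ := by
    have h1 : gradedMatrix U d q * O * (gradedMatrix U d q)⁻¹ =
        V * (Matrix.diagonal (fun k => ((q ^ d k : ℝ) : ℂ)) * O' *
          Matrix.diagonal (fun k => ((q⁻¹ ^ d k : ℝ) : ℂ))) * Vᴴ := by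
      rw [gradedMatrix_inv U d hq0, hO']
      simp only [gradedMatrix, Matrix.mul_assoc, hV]
    rw [h1]
    congr 2
    ext k l
    rw [Matrix.mul_diagonal, Matrix.diagonal_mul]
    simp only [Matrix.add_apply, Matrix.smul_apply, Matrix.conjTranspose_apply, hB, Matrix.of_apply,
      smul_eq_mul]
    rcases Nat.lt_trichotomy (d k) (d l) with h | h | h
    · rcases Nat.lt_or_ge (d k + 1) (d l) with h2 | h2
      · simp [htri' k l h2, show ¬ d l = d k + 1 by omega, show ¬ d k = d l + 1 by omega]
      · have h3 : d l = d k + 1 := by omega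
        rw [if_neg (by omega), if_pos h3, hO'H.apply, h3]
        have : ((q ^ d k : ℝ) : ℂ) * ((q⁻¹ ^ (d k + 1) : ℝ) : ℂ) = ((q⁻¹ : ℝ) : ℂ) := by
          rw [← Complex.ofReal_mul, pow_succ, ← mul_assoc, ← mul_pow, mul_inv_cancel₀ hq0.ne',
            one_pow, one_mul]
        rw [mul_right_comm, this]
        push_cast
        ring
    · rw [if_neg (by omega), if_neg (by omega), ← h]
      have : ((q ^ d k : ℝ) : ℂ) * ((q⁻¹ ^ d k : ℝ) : ℂ) = 1 := by
        rw [← Complex.ofReal_mul, ← mul_pow, mul_inv_cancel₀ hq0.ne', one_pow, Complex.ofReal_one]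
      rw [mul_right_comm, this]
      simp
    · rcases Nat.lt_or_ge (d l + 1) (d k) with h2 | h2
      · simp [show O' k l = 0 from htri k l h2, show ¬ d l = d k + 1 by omega,
          show ¬ d k = d l + 1 by omega]
      · have h3 : d k = d l + 1 := by omega
        rw [if_pos h3, if_neg (by omega), h3]
        have : ((q ^ (d l + 1) : ℝ) : ℂ) * ((q⁻¹ ^ d l : ℝ) : ℂ) = (q : ℂ) := by
          rw [← Complex.ofReal_mul, pow_succ, mul_right_comm, ← mul_pow, mul_inv_cancel₀ hq0.ne',
            one_pow, one_mul]
        rw [mul_right_comm, this]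
        push_cast
        simp only [star_zero, mul_zero, add_zero]
        ring
  have hqinv : q⁻¹ ≤ 1 := inv_le_one_of_one_le₀ hq
  have hqinv0 : 0 < q⁻¹ := inv_pos.mpr hq0
  rw [hconj, norm_unitary_conj U]
  calc ‖O' + ((q - 1 : ℝ) : ℂ) • B + ((q⁻¹ - 1 : ℝ) : ℂ) • Bᴴ‖
      ≤ ‖O'‖ + ‖((q - 1 : ℝ) : ℂ) • B‖ + ‖((q⁻¹ - 1 : ℝ) : ℂ) • Bᴴ‖ := norm_add₃_le
    _ = ‖O‖ + (q - q⁻¹) * ‖B‖ := by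
        rw [norm_unitary_conj' U O, norm_smul, norm_smul, Matrix.l2_opNorm_conjTranspose,
          Complex.norm_real, Complex.norm_real, Real.norm_of_nonneg (by linarith),
          Real.norm_of_nonpos (by linarith)]
        ring
    _ ≤ ‖O‖ + q * (g⁻¹ * ‖L * O - O * L‖) := by
        gcongr
        linarith

end Blocks

/-! ### Phase queries and the eigenbasis of the Laplacian -/

section Johnson

variable {t n : ℕ}

/-- The action of the phase query on the search inputs: `x ↦ 1 - 2 x_i = (-1) ^ x_i`. -/
def flipSign (t : ℕ) {n : ℕ} (i : Fin n) : Matrix (searchInputs t n) (searchInputs t n) ℂ :=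
  Matrix.diagonal fun x => 1 - 2 * bit i x

lemma queryOp_zero (i : Fin n) : queryOp (searchInputs t n) i 0 = 1 := by
  rw [queryOp, ← Matrix.diagonal_one]
  congr 1
  ext x
  simp

lemma queryOp_one (i : Fin n) : queryOp (searchInputs t n) i 1 = flipSign t i := by
  rw [queryOp, flipSign]
  congr 1
  ext x
  rcases bit_eq_zero_or_one i x with h | h
  all_goals
    have h' := h
    unfold bit at h'
    rw [h, h']
  · simp
  · have : (2 * Real.pi * Complex.I / ((2 : ℕ) : ℂ) * (((1 : Fin 2) : ℕ) : ℂ) * 1 : ℂ) =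
        Real.pi * Complex.I := by
      simp only [Fin.val_one, Nat.cast_one, Nat.cast_ofNat]
      ring
    rw [this, Complex.exp_pi_mul_I]
    ring

lemma flipSign_isHermitian (i : Fin n) : (flipSign t i).IsHermitian := by
  rw [Matrix.IsHermitian, flipSign, Matrix.diagonal_conjTranspose]
  congr 1
  ext x
  rcases bit_eq_zero_or_one i x with h | h <;> simp [h]

lemma flipSign_mul_self (i : Fin n) : flipSign t i * flipSign t i = 1 := by
  rw [flipSign, Matrix.diagonal_mul_diagonal, ← Matrix.diagonal_one]
  congr 1
  ext x
  rcases bit_eq_zero_or_one i x with h | h <;> simp [h]; norm_num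

lemma norm_flipSign_le (i : Fin n) : ‖flipSign t i‖ ≤ 1 := by
  rw [flipSign, Matrix.l2_opNorm_diagonal, pi_norm_le_iff_of_nonneg zero_le_one]
  intro x
  rcases bit_eq_zero_or_one i x with h | h <;> simp [h]; norm_num

lemma flipSign_unitary (i : Fin n) :
    flipSign t i ∈ Matrix.unitaryGroup (searchInputs t n) ℂ := by
  rw [Matrix.mem_unitaryGroup_iff, Matrix.star_eq_conjTranspose, (flipSign_isHermitian i).eq,
    flipSign_mul_self]

/-- Whether the bits of `x` at the positions `i` and `b` differ, as a real number. -/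
def bitsDiffer (i b : Fin n) (x : searchInputs t n) : ℝ :=
  if (x : Fin n → Fin 2) b = (x : Fin n → Fin 2) i then 0 else 1

lemma norm_bit_sub_bit (i b : Fin n) (x : searchInputs t n) :
    ‖bit b x - bit i x‖ = bitsDiffer i b x := by
  unfold bit bitsDiffer
  generalize (x : Fin n → Fin 2) i = u
  generalize (x : Fin n → Fin 2) b = v
  fin_cases u <;> fin_cases v <;> simp

lemma bitsDiffer_sq (i b : Fin n) (x : searchInputs t n) :
    bitsDiffer i b x ^ 2 = bitsDiffer i b x := by
  unfold bitsDiffer; split_ifs <;> simp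

lemma bitsDiffer_swap (i b : Fin n) (x : searchInputs t n) :
    bitsDiffer i b (permInput (Equiv.swap i b) x) = bitsDiffer i b x := by
  simp [bitsDiffer, eq_comm]

lemma sum_bitsDiffer (i : Fin n) (x : searchInputs t n) :
    ∑ b, bitsDiffer i b x = if (x : Fin n → Fin 2) i = 1 then (n : ℝ) - t else t := by
  have hones : ∑ b, (if (x : Fin n → Fin 2) b = 1 then (1 : ℝ) else 0) = t := by
    rw [Finset.sum_boole]
    exact congrArg Nat.cast (card_onesOf x)
  split_ifs with h
  · have : ∀ b, bitsDiffer i b x = 1 - (if (x : Fin n → Fin 2) b = 1 then (1 : ℝ) else 0) := by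
      intro b
      rw [bitsDiffer, h]
      split_ifs <;> simp
    simp only [this, Finset.sum_sub_distrib, hones]
    simp
  · rw [← hones]
    refine Finset.sum_congr rfl fun b _ => ?_
    unfold bitsDiffer
    revert h
    generalize (x : Fin n → Fin 2) i = u
    generalize (x : Fin n → Fin 2) b = v
    fin_cases u <;> fin_cases v <;> simp

lemma bitsDiffer_mul_sum_swap (i b : Fin n) (x : searchInputs t n) :
    bitsDiffer i b x * ∑ c, bitsDiffer i c (permInput (Equiv.swap i b) x) =
      bitsDiffer i b x * (n - ∑ c, bitsDiffer i c x) := by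
  rw [sum_bitsDiffer, sum_bitsDiffer, permInput_apply, Equiv.swap_apply_left, bitsDiffer]
  generalize (x : Fin n → Fin 2) i = u
  generalize (x : Fin n → Fin 2) b = v
  fin_cases u <;> fin_cases v <;> simp

lemma commutator_mulVec (i : Fin n) (v : searchInputs t n → ℂ) (x : searchInputs t n) :
    ((johnsonLap t n * flipSign t i - flipSign t i * johnsonLap t n) *ᵥ v) x =
      4 * ∑ b, (bit b x - bit i x) * v (permInput (Equiv.swap i b) x) := by
  set h : Fin n → Fin n → ℂ := fun a b =>
    (bit (Equiv.swap a b i) x - bit i x) * v (permInput (Equiv.swap a b) x) with hh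
  have h0 : ∀ a b, a ≠ i → b ≠ i → h a b = 0 := by
    intro a b ha hb
    simp [hh, Equiv.swap_apply_of_ne_of_ne ha.symm hb.symm]
  have hii : h i i = 0 := by simp [hh]
  have hsum : ∑ a, ∑ b, h a b = 2 * ∑ b, h i b := by
    have hrow : ∀ a ∈ Finset.univ.erase i, ∑ b, h a b = h a i := fun a ha =>
      Finset.sum_eq_single i (fun b _ hb => h0 a b (Finset.ne_of_mem_erase ha) hb) (by simp)
    have hsymm : ∀ a, h a i = h i a := fun a => by simp only [hh, Equiv.swap_comm]
    rw [← Finset.add_sum_erase _ _ (Finset.mem_univ i), Finset.sum_congr rfl hrow,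
      Finset.sum_congr rfl fun a _ => hsymm a, two_mul, add_right_inj,
      ← Finset.add_sum_erase Finset.univ (h i) (Finset.mem_univ i), hii, zero_add]
  have hi : ∑ b, (bit b x - bit i x) * v (permInput (Equiv.swap i b) x) = ∑ b, h i b := by
    simp [hh]
  have hO : ∀ w : searchInputs t n → ℂ, ∀ y, (flipSign t i *ᵥ w) y = (1 - 2 * bit i y) * w y :=
    fun w y => by rw [flipSign, Matrix.mulVec_diagonal]
  have hbit : ∀ a b, bit i (permInput (Equiv.swap a b) x) = bit (Equiv.swap a b i) x :=
    fun a b => by rw [bit, permInput_apply, bit]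
  rw [hi, Matrix.sub_mulVec, Pi.sub_apply, ← Matrix.mulVec_mulVec, ← Matrix.mulVec_mulVec, hO,
    johnsonLap_mulVec, johnsonLap_mulVec, Finset.mul_sum]
  simp only [hO, hbit, Finset.mul_sum, ← Finset.sum_sub_distrib]
  calc _ = ∑ a, ∑ b, 2 * h a b :=
        Finset.sum_congr rfl fun a _ => Finset.sum_congr rfl fun b _ => by simp only [hh]; ring
    _ = _ := by
        simp only [← Finset.mul_sum]
        rw [hsum]; ring

/-- The commutator of the Laplacian with a query joins an input with `x_i = 1` to `n - t` inputs
with `x_i = 0`, and an input with `x_i = 0` to `t` inputs with `x_i = 1`; hence its norm is of the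
order of the geometric mean of `t` and `n - t`. -/
lemma norm_commutator_le (i : Fin n) :
    ‖johnsonLap t n * flipSign t i - flipSign t i * johnsonLap t n‖ ≤ 4 * √(t * n) := by
  refine norm_le_of_sum_sq_le (by positivity) fun v => ?_
  have hrow : ∀ x, ‖((johnsonLap t n * flipSign t i - flipSign t i * johnsonLap t n) *ᵥ v) x‖ ^ 2 ≤
      16 * ∑ b, (∑ c, bitsDiffer i c x) *
        (bitsDiffer i b x * ‖v (permInput (Equiv.swap i b) x)‖ ^ 2) := by
    intro x
    rw [commutator_mulVec, norm_mul, mul_pow, ← Finset.mul_sum]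
    have h1 : ‖∑ b, (bit b x - bit i x) * v (permInput (Equiv.swap i b) x)‖ ≤
        ∑ b, bitsDiffer i b x * (bitsDiffer i b x * ‖v (permInput (Equiv.swap i b) x)‖) := by
      refine (norm_sum_le _ _).trans (Finset.sum_le_sum fun b _ => ?_)
      rw [norm_mul, norm_bit_sub_bit, ← mul_assoc, ← sq, bitsDiffer_sq]
    have h2 := Finset.sum_mul_sq_le_sq_mul_sq Finset.univ (fun b => bitsDiffer i b x)
      (fun b => bitsDiffer i b x * ‖v (permInput (Equiv.swap i b) x)‖)
    simp only [mul_pow, bitsDiffer_sq] at h2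
    have h3 := (pow_le_pow_left₀ (norm_nonneg _) h1 2).trans h2
    norm_num
    exact h3
  have hcol : ∀ b, ∑ x, (∑ c, bitsDiffer i c x) *
      (bitsDiffer i b x * ‖v (permInput (Equiv.swap i b) x)‖ ^ 2) =
      ∑ x, bitsDiffer i b x * (n - ∑ c, bitsDiffer i c x) * ‖v x‖ ^ 2 := by
    intro b
    rw [← Equiv.sum_comp (permInput (Equiv.swap i b))]
    refine Finset.sum_congr rfl fun x _ => ?_
    have hinv : permInput (Equiv.swap i b) (permInput (Equiv.swap i b) x) = x := by
      rw [← Equiv.Perm.mul_apply, ← permInput_mul, Equiv.swap_mul_self, permInput_one,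
        Equiv.Perm.one_apply]
    rw [hinv, bitsDiffer_swap, ← bitsDiffer_mul_sum_swap]
    ring
  have htn : ∀ x : searchInputs t n, (∑ b, bitsDiffer i b x) * (n - ∑ c, bitsDiffer i c x) ≤ (t * n : ℝ) := by
    intro x
    rw [sum_bitsDiffer]
    split_ifs <;> nlinarith [sq_nonneg (t : ℝ)]
  calc _ ≤ ∑ x, 16 * ∑ b, (∑ c, bitsDiffer i c x) *
        (bitsDiffer i b x * ‖v (permInput (Equiv.swap i b) x)‖ ^ 2) :=
        Finset.sum_le_sum fun x _ => hrow x
    _ = 16 * ∑ x, (∑ b, bitsDiffer i b x) * (n - ∑ c, bitsDiffer i c x) * ‖v x‖ ^ 2 := by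
        rw [← Finset.mul_sum, Finset.sum_comm]
        simp only [hcol]
        rw [Finset.sum_comm]
        simp only [Finset.sum_mul]
    _ ≤ 16 * ∑ x, (t * n : ℝ) * ‖v x‖ ^ 2 := by
        refine mul_le_mul_of_nonneg_left (Finset.sum_le_sum fun x _ => ?_) (by norm_num)
        exact mul_le_mul_of_nonneg_right (htn x) (by positivity)
    _ = (4 * √(t * n)) ^ 2 * ∑ x, ‖v x‖ ^ 2 := by
        rw [← Finset.mul_sum, mul_pow, Real.sq_sqrt (by positivity)]
        ring

lemma johnsonEig_sub (n j k : ℕ) :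
    johnsonEig n j - johnsonEig n k = 2 * ((j : ℝ) - k) * (n + 1 - j - k) := by
  unfold johnsonEig; ring

lemma johnsonEig_ne {j k : ℕ} (htn : 2 * t ≤ n) (hj : j ≤ t) (hk : k < j) :
    johnsonEig n j ≠ johnsonEig n k := by
  have h1 : (j : ℝ) ≤ t := by exact_mod_cast hj
  have h2 : (k : ℝ) + 1 ≤ j := by exact_mod_cast hk
  have h3 : (2 * t : ℝ) ≤ n := by exact_mod_cast htn
  rw [← sub_ne_zero, johnsonEig_sub]
  have h4 : (0 : ℝ) < j - k := by linarith
  have h5 : (0 : ℝ) < n + 1 - j - k := by linarith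
  positivity

/-- Every eigenvector of the Laplacian has an exact degree `j`, which determines its eigenvalue. -/
lemma exists_degree {v : searchInputs t n → ℂ} (hv0 : v ≠ 0) {μ : ℝ}
    (hv : johnsonLap t n *ᵥ v = (μ : ℂ) • v) :
    ∃ j ≤ t, μ = johnsonEig n j ∧ v ∈ degLE t n j := by
  classical
  have hex : ∃ j, v ∈ degLE t n j := ⟨t, by rw [degLE_self]; exact Submodule.mem_top⟩
  refine ⟨Nat.find hex, Nat.find_min' hex (by rw [degLE_self]; exact Submodule.mem_top), ?_,
    Nat.find_spec hex⟩
  have hmem := Nat.find_spec hex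
  by_contra hne
  rcases hj : Nat.find hex with _ | j
  · rw [hj] at hmem hne
    have h0 : (μ : ℂ) • v = 0 := by rw [← hv, johnsonLap_of_mem_degLE_zero hmem]
    rcases smul_eq_zero.mp h0 with h | h
    · exact hne (by simpa [johnsonEig] using h)
    · exact hv0 h
  · rw [hj] at hmem hne
    have h1 := johnsonLap_sub_mem hmem
    rw [hv, ← sub_smul] at h1
    have hc : (μ : ℂ) - (johnsonEig n (j + 1) : ℂ) ≠ 0 := by
      rw [sub_ne_zero]; exact_mod_cast hne
    have h2 : v ∈ degLE t n j := by
      have := Submodule.smul_mem _ ((μ : ℂ) - (johnsonEig n (j + 1) : ℂ))⁻¹ h1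
      rwa [inv_smul_smul₀ hc] at this
    exact Nat.find_min hex (by omega) h2

/-- An eigenvector of degree `j` is orthogonal to all polynomials of smaller degree. -/
lemma star_dotProduct_eq_zero (htn : 2 * t ≤ n) {j : ℕ} (hj : j ≤ t) {v : searchInputs t n → ℂ}
    (hv : johnsonLap t n *ᵥ v = (johnsonEig n j : ℂ) • v) {m : ℕ} (hm : m < j)
    {u : searchInputs t n → ℂ} (hu : u ∈ degLE t n m) : star v ⬝ᵥ u = 0 := by
  have hself : ∀ u, star v ⬝ᵥ (johnsonLap t n *ᵥ u) = (johnsonEig n j : ℂ) * (star v ⬝ᵥ u) := by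
    intro u
    rw [Matrix.dotProduct_mulVec]
    nth_rewrite 1 [← (johnsonLap_isHermitian t n).eq]
    rw [← Matrix.star_mulVec, hv, star_smul, smul_dotProduct, smul_eq_mul]
    simp
  -- The pairing with `(L - θ_m) u`, of smaller degree, is `θ_j - θ_m` times the one with `u`.
  have hred : ∀ m < j, ∀ u : searchInputs t n → ℂ,
      star v ⬝ᵥ (johnsonLap t n *ᵥ u - (johnsonEig n m : ℂ) • u) = 0 → star v ⬝ᵥ u = 0 := by
    intro m hm u h
    rw [dotProduct_sub, hself, dotProduct_smul, smul_eq_mul, ← sub_mul] at h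
    refine (mul_eq_zero.mp h).resolve_left (sub_ne_zero.mpr ?_)
    exact_mod_cast johnsonEig_ne htn hj hm
  induction m generalizing u with
  | zero =>
    apply hred 0 hm
    rw [johnsonLap_of_mem_degLE_zero hu]
    simp [johnsonEig]
  | succ m ih => exact hred _ hm _ (ih (by omega) (johnsonLap_sub_mem hu))

/-- The columns of `U` are an orthonormal eigenbasis of the Laplacian, and `d k` is the exact degree
of the column `k`: it is a polynomial of degree at most `d k`, orthogonal to all polynomials of
smaller degree. -/
structure IsGradedEigenbasis (U : Matrix.unitaryGroup (searchInputs t n) ℂ)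
    (d : searchInputs t n → ℕ) : Prop where
  le : ∀ k, d k ≤ t
  mul_eq : johnsonLap t n * (U : Matrix (searchInputs t n) (searchInputs t n) ℂ) =
    (U : Matrix (searchInputs t n) (searchInputs t n) ℂ) *
      Matrix.diagonal fun k => (johnsonEig n (d k) : ℂ)
  col_mem : ∀ k, (U : Matrix (searchInputs t n) (searchInputs t n) ℂ).col k ∈ degLE t n (d k)
  orthogonal : ∀ k m, m < d k → ∀ u ∈ degLE t n m,
    ((U : Matrix (searchInputs t n) (searchInputs t n) ℂ)ᴴ *ᵥ u) k = 0

lemma exists_isGradedEigenbasis (htn : 2 * t ≤ n) :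
    ∃ (U : Matrix.unitaryGroup (searchInputs t n) ℂ) (d : searchInputs t n → ℕ),
      IsGradedEigenbasis U d := by
  set hL := johnsonLap_isHermitian t n
  have hcol : ∀ k, (hL.eigenvectorUnitary : Matrix (searchInputs t n) (searchInputs t n) ℂ).col k =
      (hL.eigenvectorBasis k).ofLp := fun k => hL.eigenvectorUnitary_col_eq k
  have heig : ∀ k, johnsonLap t n *ᵥ (hL.eigenvectorBasis k).ofLp =
      (hL.eigenvalues k : ℂ) • (hL.eigenvectorBasis k).ofLp := fun k => by
    rw [hL.mulVec_eigenvectorBasis]; ext; simp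
  have hne : ∀ k, (hL.eigenvectorBasis k).ofLp ≠ 0 := fun k h =>
    hL.eigenvectorBasis.orthonormal.ne_zero k (by ext x; exact congrFun h x)
  choose d hd using fun k => exists_degree (hne k) (heig k)
  refine ⟨hL.eigenvectorUnitary, d, fun k => (hd k).1, ?_, fun k => ?_, fun k m hm u hu => ?_⟩
  · ext x k
    rw [Matrix.mul_diagonal]
    have := congrFun (heig k) x
    rw [← hcol, (hd k).2.1] at this
    rw [mul_comm]
    exact this
  · rw [hcol]
    exact (hd k).2.2
  · have h1 := heig k
    rw [(hd k).2.1, ← hcol] at h1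
    exact star_dotProduct_eq_zero htn (hd k).1 h1 hm hu

end Johnson

/-! ### Spectrum of graded matrices, and projections of basis vectors -/

section Spectrum

variable {X : Type*} [Fintype X] [DecidableEq X]

lemma gradedMatrix_posDef (U : Matrix.unitaryGroup X ℂ) (d : X → ℕ) {q : ℝ} (hq : 0 < q) :
    (gradedMatrix U d q).PosDef := by
  have hD : (Matrix.diagonal (fun k => ((q ^ d k : ℝ) : ℂ))).PosDef := by
    rw [Matrix.posDef_diagonal_iff]
    intro k
    exact_mod_cast pow_pos hq (d k)
  refine hD.mul_mul_conjTranspose_same ?_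
  intro v w hvw
  have h : (v ᵥ* (U : Matrix X X ℂ)) ᵥ* (U : Matrix X X ℂ)ᴴ =
      (w ᵥ* (U : Matrix X X ℂ)) ᵥ* (U : Matrix X X ℂ)ᴴ := congrArg (· ᵥ* (U : Matrix X X ℂ)ᴴ) hvw
  simpa [Matrix.vecMul_vecMul, unitary_mul_conjTranspose] using h

lemma conjTranspose_mulVec_gradedMatrix (U : Matrix.unitaryGroup X ℂ) (d : X → ℕ) (q : ℝ)
    (v : X → ℂ) (k : X) :
    ((U : Matrix X X ℂ)ᴴ *ᵥ (gradedMatrix U d q *ᵥ v)) k =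
      ((q ^ d k : ℝ) : ℂ) * ((U : Matrix X X ℂ)ᴴ *ᵥ v) k := by
  rw [Matrix.mulVec_mulVec, gradedMatrix, ← Matrix.mul_assoc, ← Matrix.mul_assoc,
    unitary_conjTranspose_mul, Matrix.one_mul, ← Matrix.mulVec_mulVec, Matrix.mulVec_diagonal]

lemma conjTranspose_mulVec_injective (U : Matrix.unitaryGroup X ℂ) :
    Function.Injective ((U : Matrix X X ℂ)ᴴ *ᵥ ·) := by
  intro v w hvw
  have h := congrArg ((U : Matrix X X ℂ) *ᵥ ·) hvw
  simpa [Matrix.mulVec_mulVec, unitary_mul_conjTranspose] using h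

/-- In the coordinates of the eigenbasis, an eigenvector of the graded matrix is supported on
the degrees `j` for which `q ^ j` is its eigenvalue. -/
lemma coord_eq_zero_of_eigenvector {U : Matrix.unitaryGroup X ℂ} {d : X → ℕ} {q μ : ℝ}
    {v : X → ℂ} (hv : gradedMatrix U d q *ᵥ v = (μ : ℂ) • v) {k : X} (hk : q ^ d k ≠ μ) :
    ((U : Matrix X X ℂ)ᴴ *ᵥ v) k = 0 := by
  have h := conjTranspose_mulVec_gradedMatrix U d q v k
  rw [hv, Matrix.mulVec_smul, Pi.smul_apply, smul_eq_mul] at h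
  by_contra hne
  exact hk (by exact_mod_cast (mul_right_cancel₀ hne h).symm)

lemma mem_eigenspace_toEuclideanLin {M : Matrix X X ℂ} {μ : ℝ} {v : EuclideanSpace ℂ X} :
    v ∈ Module.End.eigenspace (Matrix.toEuclideanLin M) (μ : ℂ) ↔
      M *ᵥ v.ofLp = (μ : ℂ) • v.ofLp := by
  rw [Module.End.mem_eigenspace_iff, ← (WithLp.ofLp_injective 2).eq_iff]
  rfl

lemma norm_gradedMatrix_ge (U : Matrix.unitaryGroup X ℂ) (d : X → ℕ) (q : ℝ)
    (k : X) : q ^ d k ≤ ‖gradedMatrix U d q‖ := by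
  rw [gradedMatrix, norm_unitary_conj, Matrix.l2_opNorm_diagonal]
  refine le_trans ?_ (norm_le_pi_norm _ k)
  rw [Complex.norm_real]
  exact le_abs_self _

/-- The squared lengths of the projections of the standard basis vectors add up to the
dimension. -/
lemma sum_norm_sq_starProjection_single (T : Submodule ℂ (EuclideanSpace ℂ X)) :
    ∑ x, ‖T.starProjection (EuclideanSpace.single x (1 : ℂ))‖ ^ 2 = Module.finrank ℂ T := by
  have hproj : LinearMap.IsProj T (T.starProjection : EuclideanSpace ℂ X →ₗ[ℂ] _) :=
    ⟨fun v => T.starProjection_apply_mem v, fun v hv => T.starProjection_eq_self_iff.mpr hv⟩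
  have h := hproj.trace
  rw [LinearMap.trace_eq_sum_inner _ (EuclideanSpace.basisFun X ℂ)] at h
  have h2 : ∀ x, inner ℂ (EuclideanSpace.single x (1 : ℂ))
      (T.starProjection (EuclideanSpace.single x (1 : ℂ))) =
      ((‖T.starProjection (EuclideanSpace.single x (1 : ℂ))‖ ^ 2 : ℝ) : ℂ) := by
    intro x
    have hself := T.starProjection_eq_self_iff.mpr
      (T.starProjection_apply_mem (EuclideanSpace.single x (1 : ℂ)))
    conv_lhs => rw [← hself, ← T.inner_starProjection_left_eq_right]
    rw [inner_self_eq_norm_sq_to_K]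
    norm_cast
  simp only [EuclideanSpace.basisFun_apply, ContinuousLinearMap.coe_coe, h2] at h
  exact_mod_cast h

/-- If every projected standard basis vector has the same length, that length is given by the
dimension. -/
lemma card_mul_norm_sq_starProjection_single (T : Submodule ℂ (EuclideanSpace ℂ X))
    (hT : ∀ x y, ‖T.starProjection (EuclideanSpace.single x (1 : ℂ))‖ =
      ‖T.starProjection (EuclideanSpace.single y (1 : ℂ))‖) (x : X) :
    Fintype.card X * ‖T.starProjection (EuclideanSpace.single x (1 : ℂ))‖ ^ 2 =
      Module.finrank ℂ T := by
  rw [← sum_norm_sq_starProjection_single T, Finset.sum_congr rfl fun y _ => by rw [hT y x]]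
  simp

end Spectrum

/-! ### Success probability in low degree -/

section Degree

variable {t n : ℕ}

/-- `degLE t n m` as a subspace of Euclidean space. -/
def degLESpace (t n m : ℕ) : Submodule ℂ (EuclideanSpace ℂ (searchInputs t n)) :=
  (degLE t n m).map (WithLp.linearEquiv 2 ℂ (searchInputs t n → ℂ)).symm.toLinearMap

lemma mem_degLESpace {m : ℕ} {v : EuclideanSpace ℂ (searchInputs t n)} :
    v ∈ degLESpace t n m ↔ v.ofLp ∈ degLE t n m := by
  rw [degLESpace, Submodule.mem_map]
  constructor
  · rintro ⟨w, hw, rfl⟩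
    exact hw
  · intro h
    exact ⟨v.ofLp, h, rfl⟩

lemma finrank_degLESpace (t n m : ℕ) :
    Module.finrank ℂ (degLESpace t n m) = Module.finrank ℂ (degLE t n m) :=
  LinearEquiv.finrank_map_eq _ _

lemma norm_starProjection_degLESpace_single (m : ℕ) (x y : searchInputs t n) :
    ‖(degLESpace t n m).starProjection (EuclideanSpace.single x (1 : ℂ))‖ =
      ‖(degLESpace t n m).starProjection (EuclideanSpace.single y (1 : ℂ))‖ := by
  obtain ⟨π, rfl⟩ := exists_permInput_eq y x
  set f : EuclideanSpace ℂ (searchInputs t n) ≃ₗᵢ[ℂ] EuclideanSpace ℂ (searchInputs t n) :=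
    LinearIsometryEquiv.piLpCongrLeft 2 ℂ ℂ (permInput π) with hf
  have hfa : ∀ v x, (f v).ofLp (permInput π x) = v.ofLp x := by
    intro v x
    simp [hf, LinearIsometryEquiv.piLpCongrLeft_apply]
  have hfmap : (degLESpace t n m).map (f.toLinearEquiv : _ →ₗ[ℂ] _) = degLESpace t n m := by
    ext w
    rw [Submodule.mem_map]
    constructor
    · rintro ⟨v, hv, rfl⟩
      rw [mem_degLESpace] at hv ⊢
      convert comp_permInput_mem_degLE π⁻¹ hv using 1
      ext y
      have h := hfa v (permInput π⁻¹ y)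
      rw [← permInput_inv, ← Equiv.Perm.mul_apply, mul_inv_cancel, Equiv.Perm.one_apply] at h
      rw [← permInput_inv]
      exact h
    · intro hw
      refine ⟨f.symm w, ?_, f.apply_symm_apply w⟩
      rw [mem_degLESpace] at hw ⊢
      convert comp_permInput_mem_degLE π hw using 1
      ext y
      have h := hfa (f.symm w) y
      rw [f.apply_symm_apply] at h
      exact h.symm
  have hsingle : f.symm (EuclideanSpace.single (permInput π y) (1 : ℂ)) =
      EuclideanSpace.single y (1 : ℂ) := by
    rw [f.symm_apply_eq, hf, EuclideanSpace.piLpCongrLeft_single]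
  have h := Submodule.starProjection_map_apply f (degLESpace t n m)
    (EuclideanSpace.single (permInput π y) (1 : ℂ))
  simp only [hfmap] at h
  rw [h, hsingle, f.norm_map]

/-- The success probability in any subspace of the functions of degree at most `m` is at most
the fraction `dim / card`: an output determines the input, and all inputs are equivalent. -/
lemma norm_outputProj_comp_sq_le {m : ℕ} {S : Submodule ℂ (EuclideanSpace ℂ (searchInputs t n))}
    (hS : S ≤ degLESpace t n m) (z : {J : Finset (Fin n) // J.card = t}) :
    (n.choose t : ℝ) * ‖(Matrix.toEuclideanCLM (n := searchInputs t n) (𝕜 := ℂ)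
      (outputProj (search t n) z)).comp S.starProjection‖ ^ 2 ≤
      ∑ i ∈ Finset.range (m + 1), n.choose i := by
  set T := degLESpace t n m
  by_cases hz : ∃ x, search t n x = z
  · obtain ⟨x, rfl⟩ := hz
    have hfin : (n.choose t : ℝ) * ‖T.starProjection (EuclideanSpace.single x (1 : ℂ))‖ ^ 2 ≤
        ∑ i ∈ Finset.range (m + 1), n.choose i := by
      rw [← card_searchInputs,
        card_mul_norm_sq_starProjection_single T (norm_starProjection_degLESpace_single m) x,
        finrank_degLESpace]
      exact_mod_cast finrank_degLE_le t n m
    refine le_trans ?_ hfin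
    gcongr
    refine ContinuousLinearMap.opNorm_le_bound _ (norm_nonneg _) fun v => ?_
    set u := S.starProjection v with hu
    have huT : u ∈ T := hS (S.starProjection_apply_mem v)
    have hcoord : (Matrix.toEuclideanCLM (n := searchInputs t n) (𝕜 := ℂ)
        (outputProj (search t n) (search t n x))) u = EuclideanSpace.single x (u.ofLp x) := by
      ext y
      rw [Matrix.ofLp_toEuclideanCLM, outputProj, Matrix.mulVec_diagonal]
      by_cases hy : y = x
      · subst hy; simp
      · have : search t n y ≠ search t n x := fun h => hy (search_injective t n h)
        simp [hy, this]
    have hinner : u.ofLp x = inner ℂ (T.starProjection (EuclideanSpace.single x (1 : ℂ))) u := by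
      rw [T.inner_starProjection_left_eq_right, T.starProjection_eq_self_iff.mpr huT,
        EuclideanSpace.inner_single_left]
      simp
    rw [ContinuousLinearMap.comp_apply, ← hu, hcoord, PiLp.norm_single, hinner]
    exact (norm_inner_le_norm _ _).trans
      (mul_le_mul_of_nonneg_left (S.norm_starProjection_apply_le v) (norm_nonneg _))
  · have h0 : outputProj (search t n) z = 0 := by
      rw [outputProj, ← Matrix.diagonal_zero]
      congr 1
      ext x
      rw [if_neg fun h => hz ⟨x, h⟩]
    rw [h0, map_zero, ContinuousLinearMap.zero_comp, norm_zero]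
    norm_num
    positivity

end Degree

/-! ### The adversary matrix -/

section Adversary

variable {t n : ℕ} {U : Matrix.unitaryGroup (searchInputs t n) ℂ} {d : searchInputs t n → ℕ}

/-- A function whose coordinates of degree above `m` vanish has degree at most `m`. -/
lemma IsGradedEigenbasis.mem_degLE (h : IsGradedEigenbasis U d) {m : ℕ}
    {v : searchInputs t n → ℂ}
    (hv : ∀ k, m < d k →
      ((U : Matrix (searchInputs t n) (searchInputs t n) ℂ)ᴴ *ᵥ v) k = 0) :
    v ∈ degLE t n m := by
  set V := (U : Matrix (searchInputs t n) (searchInputs t n) ℂ) with hV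
  have hvsum : v = ∑ k, (Vᴴ *ᵥ v) k • V.col k := by
    calc v = V *ᵥ (Vᴴ *ᵥ v) := by
          rw [Matrix.mulVec_mulVec, unitary_mul_conjTranspose, Matrix.one_mulVec]
      _ = _ := by
          ext x
          simp [Matrix.mulVec, dotProduct, Matrix.col, mul_comm]
  rw [hvsum]
  refine Submodule.sum_mem _ fun k _ => ?_
  by_cases hk : m < d k
  · rw [hv k hk, zero_smul]
    exact Submodule.zero_mem _
  · exact Submodule.smul_mem _ _ (degLE_mono (not_lt.mp hk) (h.col_mem k))

lemma IsGradedEigenbasis.badSubspace_le (h : IsGradedEigenbasis U d) {q : ℝ} (hq : 1 ≤ q)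
    (m : ℕ) : badSubspace (gradedMatrix U d q) (q ^ (m + 1)) ≤ degLESpace t n m := by
  refine iSup_le fun μ v hv => ?_
  rw [mem_eigenspace_toEuclideanLin] at hv
  rw [mem_degLESpace]
  refine h.mem_degLE fun k hk => coord_eq_zero_of_eigenvector hv fun heq => ?_
  have h1 : q ^ (m + 1) ≤ q ^ d k := pow_le_pow_right₀ hq hk
  exact absurd μ.2 (not_lt.mpr (heq ▸ h1))

/-- If the functions of degree at most `m` are too few to fill the space, some eigenvector has
degree greater than `m`. -/
lemma IsGradedEigenbasis.exists_lt (h : IsGradedEigenbasis U d) {m : ℕ}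
    (hm : ∑ i ∈ Finset.range (m + 1), n.choose i < n.choose t) : ∃ k, m < d k := by
  by_contra! hcon
  have htop : degLE t n m = ⊤ := by
    rw [eq_top_iff]
    exact fun v _ => h.mem_degLE fun k hk => absurd (hcon k) (not_le.mpr hk)
  have h1 := finrank_degLE_le t n m
  rw [htop, finrank_top, Module.finrank_fintype_fun_eq_card, card_searchInputs] at h1
  omega

/-- The constant functions are fixed by the adversary matrix. -/
lemma IsGradedEigenbasis.gradedMatrix_mulVec_one (h : IsGradedEigenbasis U d) (q : ℝ) :
    gradedMatrix U d q *ᵥ (fun _ => 1) = fun _ => 1 := by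
  apply conjTranspose_mulVec_injective U
  ext k
  simp only
  rw [conjTranspose_mulVec_gradedMatrix]
  rcases Nat.eq_zero_or_pos (d k) with hk | hk
  · simp [hk]
  · rw [h.orthogonal k 0 hk _ (mem_degLE_zero.mpr ⟨1, rfl⟩), mul_zero]

lemma IsGradedEigenbasis.isLeast_eigenvalue (h : IsGradedEigenbasis U d)
    [Nonempty (searchInputs t n)] {q : ℝ} (hq : 1 ≤ q) :
    IsLeast {μ : ℝ | Module.End.HasEigenvalue (Matrix.toEuclideanLin (gradedMatrix U d q))
      (μ : ℂ)} 1 := by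
  constructor
  · refine Module.End.hasEigenvalue_of_hasEigenvector (x := WithLp.toLp 2 fun _ => 1) ⟨?_, ?_⟩
    · rw [mem_eigenspace_toEuclideanLin, h.gradedMatrix_mulVec_one]
      simp
    · intro h0
      obtain ⟨x⟩ := ‹Nonempty (searchInputs t n)›
      have : (WithLp.toLp 2 (fun _ : searchInputs t n => (1 : ℂ))).ofLp x = 0 := by
        rw [h0]; rfl
      simp at this
  · intro μ hμ
    obtain ⟨v, hv, hv0⟩ := hμ.exists_hasEigenvector
    rw [mem_eigenspace_toEuclideanLin] at hv
    by_contra hlt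
    apply hv0
    rw [← (WithLp.ofLp_injective 2).eq_iff]
    apply conjTranspose_mulVec_injective U
    ext k
    have hne : q ^ d k ≠ μ := fun heq => hlt (heq ▸ one_le_pow₀ hq)
    simp [coord_eq_zero_of_eigenvector hv hne]

/-- A query raises the degree by at most one. -/
lemma IsGradedEigenbasis.flipSign_tridiagonal (h : IsGradedEigenbasis U d) (i : Fin n)
    {k l : searchInputs t n} (hkl : d l + 1 < d k) :
    ((U : Matrix (searchInputs t n) (searchInputs t n) ℂ)ᴴ * flipSign t i *
      (U : Matrix (searchInputs t n) (searchInputs t n) ℂ)) k l = 0 := by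
  set V := (U : Matrix (searchInputs t n) (searchInputs t n) ℂ) with hV
  have hmem : flipSign t i *ᵥ V.col l ∈ degLE t n (d l + 1) := by
    have h1 := degLE_mono (Nat.le_succ _) (h.col_mem l)
    have h2 := Submodule.sub_mem _ h1 (Submodule.smul_mem _ (2 : ℂ)
      (bit_mul_mem_degLE i (h.col_mem l)))
    convert h2 using 1
    ext x
    rw [flipSign, Matrix.mulVec_diagonal]
    simp only [Pi.sub_apply, Pi.smul_apply, smul_eq_mul]
    ring
  have h3 := h.orthogonal k _ hkl _ hmem
  rw [Matrix.mulVec_mulVec] at h3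
  exact h3

lemma queriedMatrix_one_eq (Γ : Matrix (searchInputs t n) (searchInputs t n) ℂ) (i : Fin n) :
    opNorm (queriedMatrix Γ i 1 * Γ⁻¹) = ‖Γ * flipSign t i * Γ⁻¹‖ := by
  rw [opNorm_eq_norm, queriedMatrix, queryOp_one, (flipSign_isHermitian i).eq, Matrix.mul_assoc,
    Matrix.mul_assoc, ← Matrix.mul_assoc Γ]
  exact CStarRing.norm_coe_unitary_mul
    (⟨flipSign t i, flipSign_unitary i⟩ : unitary (Matrix (searchInputs t n) (searchInputs t n) ℂ))
    _

lemma IsGradedEigenbasis.queryFactor_le (h : IsGradedEigenbasis U d) (hn : 0 < n)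
    (htn : 4 * t ≤ n) {q : ℝ} (hq : 1 ≤ q) :
    queryFactor (gradedMatrix U d q) ≤ 1 + q * ((n : ℝ)⁻¹ * (4 * √(t * n))) := by
  have hpos : 0 ≤ q * ((n : ℝ)⁻¹ * (4 * √(t * n))) := by positivity
  have : Nonempty (Fin n × Fin 2) := ⟨(⟨0, hn⟩, 0)⟩
  refine ciSup_le fun ⟨i, p⟩ => ?_
  obtain rfl | rfl := Fin.exists_fin_two.mp ⟨p, rfl⟩ |>.imp Eq.symm Eq.symm
  · have hinv : gradedMatrix U d q * (gradedMatrix U d q)⁻¹ = 1 := by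
      rw [gradedMatrix_inv U d (by linarith), gradedMatrix_mul_inv U d (by linarith)]
    simp only [queriedMatrix, queryOp_zero, Matrix.conjTranspose_one, Matrix.one_mul,
      Matrix.mul_one, hinv, opNorm_eq_norm]
    have hone : ‖(1 : Matrix (searchInputs t n) (searchInputs t n) ℂ)‖ ≤ 1 := by
      rw [← Matrix.diagonal_one, Matrix.l2_opNorm_diagonal, pi_norm_le_iff_of_nonneg zero_le_one]
      simp
    linarith
  · simp only [queriedMatrix_one_eq]
    have hgap : ∀ k, (n : ℝ) ≤ johnsonEig n (d k + 1) - johnsonEig n (d k) := by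
      intro k
      have h1 : (d k : ℝ) ≤ t := by exact_mod_cast h.le k
      have h2 : (4 * t : ℝ) ≤ n := by exact_mod_cast htn
      rw [johnsonEig_sub]
      push_cast
      linarith
    have hmain := norm_gradedMatrix_conj_le hq (flipSign_isHermitian (t := t) i)
      (Nat.cast_pos.mpr hn) h.mul_eq hgap fun k l hkl => h.flipSign_tridiagonal i hkl
    refine hmain.trans ?_
    gcongr
    · exact norm_flipSign_le i
    · exact norm_commutator_le i

/-- A query moves the constant function out of the constants, where the adversary matrix is
expanding. -/
lemma IsGradedEigenbasis.one_lt_queryFactor (h : IsGradedEigenbasis U d) (ht : 0 < t)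
    (htn : t < n) {q : ℝ} (hq : 1 < q) : 1 < queryFactor (gradedMatrix U d q) := by
  set Γ := gradedMatrix U d q with hΓ
  set V := (U : Matrix (searchInputs t n) (searchInputs t n) ℂ) with hV
  set i : Fin n := ⟨0, by omega⟩
  set w : searchInputs t n → ℂ := flipSign t i *ᵥ fun _ => 1 with hw
  have hle : ‖Γ * flipSign t i * Γ⁻¹‖ ≤ queryFactor Γ := by
    rw [← queriedMatrix_one_eq]
    exact le_ciSup (f := fun ip : Fin n × Fin 2 => opNorm (queriedMatrix Γ ip.1 ip.2 * Γ⁻¹))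
      (Set.finite_range _).bddAbove (i, 1)
  refine lt_of_lt_of_le ?_ hle
  have hwval : ∀ x, w x = 1 - 2 * bit i x := fun x => by
    rw [hw, flipSign, Matrix.mulVec_diagonal, mul_one]
  have hnorm : ∀ v : searchInputs t n → ℂ, ∑ k, ‖(Vᴴ *ᵥ v) k‖ ^ 2 = ∑ x, ‖v x‖ ^ 2 := by
    have hnorm1 : ∀ W : Matrix.unitaryGroup (searchInputs t n) ℂ, ∀ v : searchInputs t n → ℂ,
        ∑ k, ‖((W : Matrix (searchInputs t n) (searchInputs t n) ℂ) *ᵥ v) k‖ ^ 2 ≤ ∑ x, ‖v x‖ ^ 2 := by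
      intro W v
      have h1 := sum_sq_mulVec_le (W : Matrix (searchInputs t n) (searchInputs t n) ℂ) v
      have h2 : ‖(W : Matrix (searchInputs t n) (searchInputs t n) ℂ)‖ ≤ 1 := by
        have h3 := CStarRing.norm_coe_unitary_mul W (1 : Matrix (searchInputs t n) _ ℂ)
        rw [mul_one] at h3
        rw [h3, ← Matrix.diagonal_one, Matrix.l2_opNorm_diagonal,
          pi_norm_le_iff_of_nonneg zero_le_one]
        simp
      refine h1.trans (mul_le_of_le_one_left (by positivity) ?_)
      exact pow_le_one₀ (norm_nonneg _) h2
    intro v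
    refine le_antisymm (hnorm1 (star U) v) ?_
    have h4 := hnorm1 U (Vᴴ *ᵥ v)
    rwa [Matrix.mulVec_mulVec, unitary_mul_conjTranspose, Matrix.one_mulVec] at h4
  -- Some inputs `x` and `y` have `x_i = 1` and `y_i = 0`, so `w` is not constant.
  have hnonconst : ∃ k, 0 < d k ∧ (Vᴴ *ᵥ w) k ≠ 0 := by
    by_contra! hcon
    obtain ⟨c, hc⟩ := mem_degLE_zero.mp (h.mem_degLE hcon)
    obtain ⟨J, hiJ, hJ⟩ : ∃ J : Finset (Fin n), i ∈ J ∧ J.card = t := by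
      obtain ⟨J, h1, -, h2⟩ := Finset.exists_subsuperset_card_eq
        (Finset.subset_univ ({i} : Finset (Fin n))) (n := t) (by rw [Finset.card_singleton]; exact ht)
        (by simpa using htn.le)
      exact ⟨J, h1 (Finset.mem_singleton_self i), h2⟩
    obtain ⟨K, hiK, hK⟩ : ∃ K : Finset (Fin n), i ∉ K ∧ K.card = t := by
      obtain ⟨K, h1, h2⟩ := Finset.exists_subset_card_eq (s := ({i} : Finset (Fin n))ᶜ) (n := t)
        (by rw [Finset.card_compl]; simp; omega)
      exact ⟨K, fun hi => by simpa using h1 hi, h2⟩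
    have hinput : ∀ A : Finset (Fin n), A.card = t → ∃ x : searchInputs t n,
        ∀ a, (x : Fin n → Fin 2) a = if a ∈ A then 1 else 0 := by
      intro A hA
      refine ⟨⟨fun a => if a ∈ A then 1 else 0, ?_⟩, fun a => rfl⟩
      have : onesOf (fun a => if a ∈ A then (1 : Fin 2) else 0) = A := by
        ext a; simp [onesOf]
      simp [searchInputs, this, hA]
    obtain ⟨x, hx⟩ := hinput J hJ
    obtain ⟨y, hy⟩ := hinput K hK
    have h1 := hwval x
    have h2 := hwval y
    rw [bit_eq_ite, hx, if_pos hiJ, if_pos rfl, hc] at h1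
    rw [bit_eq_ite, hy, if_neg hiK, if_neg (by decide), hc] at h2
    have h3 : c = -1 := by simp only at h1; rw [h1]; norm_num
    have h4 : c = 1 := by simp only at h2; rw [h2]; norm_num
    rw [h3] at h4
    norm_num at h4
  by_contra! hcon
  have hΓinv : Γ⁻¹ *ᵥ (fun _ => 1) = fun _ => (1 : ℂ) := by
    rw [hΓ, gradedMatrix_inv U d (by linarith)]
    exact h.gradedMatrix_mulVec_one _
  have hone := sum_sq_mulVec_le (Γ * flipSign t i * Γ⁻¹) (fun _ => 1)
  rw [← Matrix.mulVec_mulVec, hΓinv, ← Matrix.mulVec_mulVec, ← hw] at hone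
  have hΓw : ∑ x, ‖(Γ *ᵥ w) x‖ ^ 2 ≤ ∑ x, ‖w x‖ ^ 2 := by
    have hunit : ∀ x, ‖w x‖ = ‖(1 : ℂ)‖ := by
      intro x
      rw [hwval]
      rcases bit_eq_zero_or_one i x with hb | hb <;> rw [hb] <;> norm_num
    simp only [hunit]
    exact hone.trans (mul_le_of_le_one_left (by positivity) (pow_le_one₀ (norm_nonneg _) hcon))
  rw [← hnorm, ← hnorm w] at hΓw
  refine absurd hΓw (not_le.mpr ?_)
  obtain ⟨k₀, hk₀, hne⟩ := hnonconst
  have hval : ∀ k, ‖(Vᴴ *ᵥ (Γ *ᵥ w)) k‖ ^ 2 = (q ^ d k) ^ 2 * ‖(Vᴴ *ᵥ w) k‖ ^ 2 := by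
    intro k
    rw [conjTranspose_mulVec_gradedMatrix, norm_mul, mul_pow, Complex.norm_real,
      Real.norm_of_nonneg (by positivity)]
  simp only [hval]
  refine Finset.sum_lt_sum (fun k _ => ?_) ⟨k₀, Finset.mem_univ _, ?_⟩
  · exact le_mul_of_one_le_left (by positivity) (one_le_pow₀ (one_le_pow₀ hq.le))
  · exact lt_mul_of_one_lt_left (by positivity)
      (one_lt_pow₀ (one_lt_pow₀ hq hk₀.ne') two_ne_zero)

end Adversary

/-! ### Choice of the threshold and the base -/

section Numerics

lemma nine_mul_choose_le {t n i : ℕ} (htn : 10 * t ≤ n) (hi : i < t) :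
    9 * n.choose i ≤ n.choose (i + 1) := by
  have h := Nat.choose_succ_right_eq n i
  have h1 : 9 * (i + 1) ≤ n - i := by omega
  have h2 : n.choose i * (9 * (i + 1)) ≤ n.choose i * (n - i) := Nat.mul_le_mul_left _ h1
  rw [← h] at h2
  refine Nat.le_of_mul_le_mul_right (c := i + 1) ?_ (Nat.succ_pos i)
  linarith

lemma two_mul_sum_choose_le {t n m : ℕ} (htn : 10 * t ≤ n) (hm : m < t) :
    2 * ∑ i ∈ Finset.range (m + 1), n.choose i ≤ n.choose (m + 1) := by
  have h := nine_mul_choose_le htn hm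
  induction m with
  | zero =>
    simp only [zero_add, Finset.range_one, Finset.sum_singleton] at h ⊢
    omega
  | succ m ih =>
    have h1 := ih (by omega) (nine_mul_choose_le htn (by omega))
    rw [Finset.sum_range_succ]
    omega

lemma two_pow_mul_sum_choose_le {t n m : ℕ} (htn : 10 * t ≤ n) (hm : m < t) :
    2 ^ (t - m) * ∑ i ∈ Finset.range (m + 1), n.choose i ≤ n.choose t := by
  obtain ⟨k, rfl⟩ : ∃ k, t = m + 1 + k := ⟨t - (m + 1), by omega⟩
  have hchain : ∀ j ≤ k, 2 ^ j * n.choose (m + 1) ≤ n.choose (m + 1 + j) := by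
    intro j hj
    induction j with
    | zero => simp
    | succ j ih =>
      have h1 := ih (by omega)
      have h2 := nine_mul_choose_le (i := m + 1 + j) htn (by omega)
      rw [pow_succ, ← add_assoc]
      linarith
  have h1 := two_mul_sum_choose_le htn hm
  calc 2 ^ (m + 1 + k - m) * ∑ i ∈ Finset.range (m + 1), n.choose i
      = 2 ^ k * (2 * ∑ i ∈ Finset.range (m + 1), n.choose i) := by
        rw [show m + 1 + k - m = k + 1 by omega, pow_succ, mul_assoc]
    _ ≤ 2 ^ k * n.choose (m + 1) := Nat.mul_le_mul_left _ h1
    _ ≤ _ := hchain k le_rfl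

lemma IsGradedEigenbasis.isMultAdversary {t n : ℕ}
    {U : Matrix.unitaryGroup (searchInputs t n) ℂ} {d : searchInputs t n → ℕ}
    (h : IsGradedEigenbasis U d) (ht : 1 ≤ t) (htn : 10 * t ≤ n) {q : ℝ} (hq : 1 < q) :
    IsMultAdversary (search t n) ((2 : ℝ) ^ (-(t : ℝ) / 2)) (gradedMatrix U d q)
      (q ^ ((t - 1) / 2 + 1)) := by
  set m := (t - 1) / 2
  have hm : m < t := by omega
  have hsum := two_pow_mul_sum_choose_le htn hm
  have hspos : 0 < ∑ i ∈ Finset.range (m + 1), n.choose i :=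
    Finset.sum_pos (fun i hi => Nat.choose_pos (by rw [Finset.mem_range] at hi; omega)) (by simp)
  have hcpos : 0 < n.choose t := Nat.choose_pos (by omega)
  have : Nonempty (searchInputs t n) := by
    rw [← Fintype.card_pos_iff, card_searchInputs]
    exact hcpos
  refine ⟨gradedMatrix_posDef U d (by linarith), h.isLeast_eigenvalue hq.le,
    one_lt_pow₀ hq (by omega), ?_, fun z => ?_⟩
  · obtain ⟨k, hk⟩ := h.exists_lt (m := m) (by
      have h2 : 2 ≤ 2 ^ (t - m) := le_self_pow₀ one_le_two (by omega)
      nlinarith)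
    exact (pow_le_pow_right₀ hq.le hk).trans (norm_gradedMatrix_ge U d q k)
  · have h1 := norm_outputProj_comp_sq_le (h.badSubspace_le hq.le m) z
    set p := ‖(Matrix.toEuclideanCLM (n := searchInputs t n) (𝕜 := ℂ)
      (outputProj (search t n) z)).comp
        (badSubspace (gradedMatrix U d q) (q ^ (m + 1))).starProjection‖ ^ 2
    have h2 : (2 : ℝ) ^ (t - m) * (∑ i ∈ Finset.range (m + 1), n.choose i : ℕ) ≤ n.choose t := by
      exact_mod_cast hsum
    have h3 : (2 : ℝ) ^ (t - m) * p ≤ 1 := by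
      have hc : (0 : ℝ) < n.choose t := by exact_mod_cast hcpos
      refine le_of_mul_le_mul_left ?_ hc
      calc (n.choose t : ℝ) * (2 ^ (t - m) * p) = 2 ^ (t - m) * (n.choose t * p) := by ring
        _ ≤ 2 ^ (t - m) * (∑ i ∈ Finset.range (m + 1), n.choose i : ℕ) := by
            push_cast at h1 ⊢
            gcongr
        _ ≤ n.choose t * 1 := by rw [mul_one]; exact h2
    have h4 : (2 : ℝ) ^ ((t : ℝ) / 2) ≤ (2 : ℝ) ^ (t - m) := by
      rw [← Real.rpow_natCast]
      refine Real.rpow_le_rpow_of_exponent_le one_le_two ?_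
      rw [div_le_iff₀ two_pos]
      have : t ≤ (t - m) * 2 := by omega
      exact_mod_cast this
    rw [neg_div, Real.rpow_neg two_pos.le, ← one_div, le_div_iff₀ (by positivity), mul_comm]
    exact (mul_le_mul_of_nonneg_right h4 (by positivity)).trans h3

/-- The base `q = 2 ^ 10` of the adversary matrix outweighs the loss `ζ² = 2 ^ (-t/4) / 16`. -/
lemma log_success_ge {t : ℕ} (ht : 1 ≤ t) :
    3 / 4 * t * Real.log 2 ≤
      Real.log (((2 : ℝ) ^ (-(t : ℝ) / 8) / 4) ^ 2 * (2 ^ 10) ^ ((t - 1) / 2 + 1)) := by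
  set m := (t - 1) / 2 with hm
  have hval : Real.log (((2 : ℝ) ^ (-(t : ℝ) / 8) / 4) ^ 2 * (2 ^ 10) ^ (m + 1)) =
      (-(t : ℝ) / 4 - 4 + 10 * (m + 1)) * Real.log 2 := by
    have h4 : Real.log 4 = 2 * Real.log 2 := by
      rw [show (4 : ℝ) = 2 ^ 2 by norm_num, Real.log_pow]; norm_num
    rw [Real.log_mul (by positivity) (by positivity), Real.log_pow, Real.log_pow, Real.log_pow,
      Real.log_div (by positivity) (by norm_num), Real.log_rpow two_pos, h4]
    push_cast
    ring
  rw [hval]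
  have hlog : 0 < Real.log 2 := Real.log_pos one_lt_two
  have h1 : (t : ℝ) ≤ 2 * (m + 1) := by
    have : t ≤ 2 * (m + 1) := by omega
    exact_mod_cast this
  have h2 : (1 : ℝ) ≤ t := by exact_mod_cast ht
  refine mul_le_mul_of_nonneg_right ?_ hlog.le
  linarith

end Numerics

theorem mainTheorem4 :
    ∃ c : ℝ, 0 < c ∧ ∀ t n : ℕ, 1 ≤ t → (t : ℝ) ≤ (n : ℝ) / (4 * Real.exp 1) →
      ((c * Real.sqrt ((t : ℝ) * (n : ℝ)) : ℝ) : EReal) ≤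
        madv (search t n) ((2 : ℝ) ^ (-(t : ℝ) / 2)) ((2 : ℝ) ^ (-(t : ℝ) / 8)) := by
  have hlog : 0 < Real.log 2 := Real.log_pos one_lt_two
  refine ⟨3 / 4 * Real.log 2 / (2 ^ 10 * 4), by positivity, fun t n ht htn => ?_⟩
  have h10 : 10 * t ≤ n := by
    have he := Real.exp_one_gt_d9
    rw [le_div_iff₀ (by positivity)] at htn
    have : (10 * t : ℝ) ≤ n := by nlinarith [(Nat.cast_nonneg t : (0 : ℝ) ≤ t)]
    exact_mod_cast this
  obtain ⟨U, d, hU⟩ := exists_isGradedEigenbasis (t := t) (n := n) (by omega)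
  have hq : (1 : ℝ) < 2 ^ 10 := by norm_num
  refine le_trans ?_ (le_sSup ⟨gradedMatrix U d (2 ^ 10), (2 ^ 10) ^ ((t - 1) / 2 + 1),
    hU.isMultAdversary ht h10 hq, rfl⟩)
  rw [EReal.coe_le_coe_iff]
  have hnpos : (0 : ℝ) < n := by exact_mod_cast (by omega : 0 < n)
  have htpos : (0 : ℝ) < t := by exact_mod_cast ht
  have hone := hU.one_lt_queryFactor ht (by omega) hq
  have hden : Real.log (queryFactor (gradedMatrix U d (2 ^ 10))) ≤
      2 ^ 10 * ((n : ℝ)⁻¹ * (4 * √(t * n))) := by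
    refine (Real.log_le_sub_one_of_pos (by linarith)).trans ?_
    linarith [hU.queryFactor_le (by omega) (by omega) hq.le]
  rw [le_div_iff₀ (Real.log_pos hone)]
  refine le_trans ?_ (log_success_ge ht)
  calc 3 / 4 * Real.log 2 / (2 ^ 10 * 4) * √(t * n) *
        Real.log (queryFactor (gradedMatrix U d (2 ^ 10)))
      ≤ 3 / 4 * Real.log 2 / (2 ^ 10 * 4) * √(t * n) *
        (2 ^ 10 * ((n : ℝ)⁻¹ * (4 * √(t * n)))) := by gcongr
    _ = 3 / 4 * Real.log 2 * (n : ℝ)⁻¹ * (√(t * n) * √(t * n)) := by ring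
    _ = 3 / 4 * t * Real.log 2 := by
        rw [Real.mul_self_sqrt (by positivity)]
        field_simp
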